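/- Fix an integer $k\ge 1$ and a set $\mathsf{Var}$ of variables. **Logic.** Quantifier-free $\mathsf{SL}^k$ formulae are $\varphi ::= \bot\mid\top\mid\mathsf{emp}\mid x\approx y\mid x\mapsto(y_1,\dots,y_k)\mid\varphi\wedge\varphi\mid\neg\varphi\mid\varphi*\varphi\mid\varphi\mathrel{-\!\!*}\varphi$, and $\varphi\multimap\psi$ abbreviates $\neg(\varphi\mathrel{-\!\!*}\neg\psi)$. They are interpreted over structures $(\mathfrak U,\mathfrak s,\mathfrak h)$: a nonempty set $\mathfrak U$, a store $\mathfrak s:\mathsf{Var}\to\mathfrak U$, and a heap $\mathfrak h$, i.e. a partial function $\mathfrak U\rightharpoonup\mathfrak U^k$ with finite domain, of size $|\mathfrak h|=|\mathrm{dom}(\mathfrak h)|$. Here $\mathsf{emp}$ says $\mathfrak h=\emptyset$; $x\mapsto\vec y$ says $\mathfrak h=\{(\mathfrak s(x),\mathfrak s(\vec y))\}$; $\varphi_1*\varphi_2$ says that $\mathfrak h=\mathfrak h_1\uplus\mathfrak h_2$ with $\mathfrak h_i$ satisfying $\varphi_i$; $\varphi_1\mathrel{-\!\!*}\varphi_2$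 says that $\mathfrak h'\uplus\mathfrak h$ satisfies $\varphi_2$ for every heap $\mathfrak h'$ disjoint from $\mathfrak h$ and satisfying $\varphi_1$. Write $\varphi\equiv^{fin}\psi$ (resp. $\varphi\equiv^{inf}\psi$) if $\varphi,\psi$ agree on all structures with $\mathfrak U$ finite (resp. infinite). **Test formulae and minterms.** Test formulae are $x\approx y$; $x\hookrightarrow\vec y:=x\mapsto\vec y*\top$; $\mathsf{alloc}(x):=x\mapsto(x,\dots,x)\mathrel{-\!\!*}\bot$; $|h|\ge n$, defined by $|h|\ge0:=\top$, $|h|\ge n+1:=(|h|\ge n)*\neg\mathsf{emp}$, $|h|\ge\infty:=\bot$; $|U|\ge n:=\top\multimap|h|\ge n$; $|h|\ge|U|-n:=(|h|\ge n+1)\mathrel{-\!\!*}\bot$. A literal $\ell$ is a test formula or its negation, $\overline\ell$ is its complement, and $t<u$ is $\neg(t\ge u)$. A minterm $M$ is a finite conjunction (set) of literals with exactly one literal $|h|\ge\min_M$, $\min_M\in\{n,|U|-n\}$, exactly one literal $|h|<\max_M$, $\max_M\in\{n,\infty,|U|-n\}$, at most one literal $|U|\ge n$, at most one literal $|U|<n$,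 and otherwise only literals over $x\approx y$, $\mathsf{alloc}(x)$, $x\hookrightarrow\vec y$. Let $M^e,M^a,M^p,M^u$ be its literals over $\approx$, $\mathsf{alloc}$, $\hookrightarrow$, $|U|$. An empty disjunction is $\bot$, an empty conjunction $\top$. **Minterms of conjunctions of literals.** $[M_1,M_2]$ is the finite set of minterms $M_1^e\wedge M_2^e\wedge M_1^a\wedge M_2^a\wedge M_1^p\wedge M_2^p\wedge M_1^u\wedge M_2^u\wedge\mu\wedge\nu$ (keeping only the strongest literals $|U|\ge n$, $|U|<n$), where $\mu$ ranges over: $|h|\ge\max(a,b)$ if the minima are $a,b\in\mathbb N$; $(|h|\ge a\wedge|U|<a+m+1)$ and $(|h|\ge|U|-m\wedge|U|\ge a+m+1)$ if they are $a$ and $|U|-m$ in some order; $|h|\ge|U|-\min(m,n)$ if they are $|U|-m,|U|-n$. And $\nu$ ranges over: $|h|<\min(a,b)$ if the maxima are $a,b\in\mathbb N\cup\{\infty\}$; $|h|<|U|-m$ if they are $\infty$ and $|U|-m$; $(|h|<a\wedge|U|\ge a+m)$ and $(|h|<|U|-m\wedge|U|<a+m)$ if they are $a\in\mathbb N$ and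 $|U|-m$; $|h|<|U|-\max(m,n)$ if they are $|U|-m,|U|-n$. Put $[M_1,\dots,M_n]=\bigcup_{M\in[M_1,\dots,M_{n-1}]}[M,M_n]$. For a literal $\ell$, $\mathrm{mt}(\ell)$ is $\ell$ with the missing ones of $|h|\ge0$, $|h|<\infty$ added, and $\mathrm{mt}(\ell_1,\dots,\ell_n)=[\mathrm{mt}(\ell_1),\dots,\mathrm{mt}(\ell_n)]$ (empty if some $\ell_i$ is $|h|\ge\infty$; $\{|h|\ge0\wedge|h|<\infty\}$ if $n=0$). For a boolean combination $\phi$ of test formulae, $\mathrm{mt}(\phi)$ is the union of $\mathrm{mt}(L)$ over the clauses $L$ of a disjunctive normal form of $\phi$. **Notions for a set $T$ of literals.** $x\approx_Ty$ (resp. $x\not\approx_Ty$): $x\approx y$ (resp. $\neg x\approx y$) follows from the (dis)equality literals of $T$, namely $\approx_T$ is the equivalence relation generated by the equalities in $T$ and $x\not\approx_Ty$ means that $\neg x'\approx y'$ or $\neg y'\approx x'$ is in $T$ for some $x'\approx_Tx$, $y'\approx_Ty$. $|X|_T$ is the number of classes of $\approx_T$ meeting $X$. $\mathrm{av}(T)$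 (resp. $\mathrm{nv}(T)$) is the set of $x$ with $x\approx_Tx'$ for some $x'$ such that $\mathsf{alloc}(x')\in T$ or $x'\hookrightarrow\vec y\in T$ (resp. $\neg\mathsf{alloc}(x')\in T$). $\mathrm{fp}_X(T)$ is the set of literals of $T$ over $\mathsf{alloc}(x)$, $x\hookrightarrow\vec y$ with $x\in X$; $\mathrm{fp}_a(T)=\mathrm{fp}_{\mathrm{av}(T)}(T)$; $\#_a(T)=|\mathrm{av}(T)|_T$; $\#_n(X,T)=|X\cap\mathrm{nv}(T)|_T$; $\delta_x(T)$ is the number of tuples $\vec y$, up to componentwise $\approx_T$, with $\neg x'\hookrightarrow\vec y\in T$ for some $x'\approx_Tx$. $\overline T=\{\overline\ell\mid\ell\in T\}$ and $\widehat T=T\cup\overline T$. $T$ is E-complete (A-complete) for $X$ if exactly one of $x\approx y,\neg x\approx y$ (of $\mathsf{alloc}(x),\neg\mathsf{alloc}(x)$) is in $T$ for all $x,y\in X$. $T$ is footprint-consistent if, whenever $x\approx_Tx'$ and $y_i\approx_Ty_i'$ for all $i$: $\mathsf{alloc}(x)\in T$ implies $\neg\mathsf{alloc}(x')\notin T$,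 and $x\hookrightarrow\vec y\in T$ implies $\neg\mathsf{alloc}(x'),\neg x'\hookrightarrow\vec y'\notin T$. The completions $K^L$ of $K$ by $L$ are the sets $K\cup B\cup\overline{L\setminus B}$, $B\subseteq L$. $\mathrm{dc}(M)^u$ is the conjunction of $M^u$, of $|U|\ge\lceil(\max_{x\in\mathrm{av}(M)}(\delta_x(M)+1))^{1/k}\rceil$ (with $\max\emptyset=0$), and of the condition $\min_M<\max_M$ written as: $\top$ or $\bot$ if both are numbers or both are $|U|-n$, or if $\max_M=\infty$; $|U|\ge n_1+n_2+1$ for $n_1<|U|-n_2$; $|U|<n_1+n_2$ for $|U|-n_1<n_2$. $\mathrm{pc}(M)^e$ is $\bot$ if some $x\hookrightarrow\vec y,x'\hookrightarrow\vec y'\in M$ have $x\approx_Mx'$ and $y_i\not\approx_My'_i$ for some $i$, and $M^e$ otherwise. Comparisons between $|h|$, $|U|$, integers and $\infty$ below denote boolean combinations of test formulae as follows: $|h|\ge\beta$ is $|h|\ge\max(\beta,0)$; $|h|\ge|U|+\beta$ is a test formula for $\beta\le0$ and $\bot$ for $\beta>0$; $|h|\ge\alpha|U|+\beta$ with $\alpha>1$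 is $\bot$ if $\beta>0$ and otherwise $|U|<N+1\wedge\bigwedge_{n=1}^{N}(|U|\approx n\to|h|\ge\alpha n+\beta)$ with $N=\lfloor-\beta/(\alpha-1)\rfloor$; with $\alpha<0$ it is $\top$ if $\beta<0$ and otherwise $\bigwedge_{n=1}^{\lfloor-\beta/\alpha\rfloor}(|U|\approx n\to|h|\ge\alpha n+\beta)$; here $|U|\approx n$ is $|U|\ge n\wedge|U|<n+1$; comparisons not involving $|h|$ are rearranged to $|U|\ge n$, $\top$ or $\bot$; an upper bound involving $+\infty$ and a lower bound involving $-\infty$ are $\top$. **Elimination formulae.** $\mathrm{elim}_*(M_1,M_2)$ is the conjunction of $M_1^e$, $M_2^e$, $\mathrm{dc}(M_1)^u$, $\mathrm{dc}(M_2)^u$; $\neg x\approx y$ for $x\in\mathrm{av}(M_1),y\in\mathrm{av}(M_2)$; $\mathrm{fp}_a(M_1)$, $\mathrm{fp}_a(M_2)$; $\neg\mathsf{alloc}(x)$ for $x\in\mathrm{nv}(M_1)\cap\mathrm{nv}(M_2)$; all $\neg x\hookrightarrow\vec y\in M_1\cap M_2$ with $x\notin\mathrm{av}(M_1\cup M_2)$;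 $|h|\ge\min_{M_1}+\min_{M_2}$; $|h|<\max_{M_1}+\max_{M_2}-1$; $\eta_{12}$ and $\eta_{21}$, where $$\eta_{ij}=\bigwedge_{Y\subseteq\mathrm{nv}(M_j)\setminus\mathrm{av}(M_i)}\Big(\bigwedge_{y\in Y}\mathsf{alloc}(y)\to|h|\ge\#_a(M_i)+|Y|_{M_i}+\mathrm{min}_{M_j}\wedge\#_a(M_i)+|Y|_{M_i}<\mathrm{max}_{M_i}\Big).$$ For $\dagger\in\{fin,inf\}$, $\mathrm{elim}^\dagger_{\multimap}(M_1,M_2)$ is the conjunction of $\mathrm{pc}(M_1)^e$, $M_2^e$, $\mathrm{dc}(M_1)^u$, $\mathrm{dc}(M_2)^u$; $\neg\mathsf{alloc}(x)$ for $x\in\mathrm{av}(M_1)$; $\mathrm{fp}_{\mathrm{nv}(M_1)}(M_2)$; $|h|\ge\min_{M_2}-\max_{M_1}+1$; $|h|<\max_{M_2}-\min_{M_1}$; $\lambda^\dagger$; $\#_a(M_1)<\max_{M_1}$; and $|h|<\max_{M_2}-\#_a(M_1)$; where $\lambda^{inf}=\top$ and $$\lambda^{fin}=\bigwedge_{Y\subseteq\mathrm{fv}(M_1\cup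 M_2)}\Big(\bigwedge_{y\in Y}\neg\mathsf{alloc}(y)\to|h|<|U|-\mathrm{min}_{M_1}-\#_n(Y,M_1)+1\wedge|U|\ge\mathrm{min}_{M_2}+\#_n(Y,M_1)\Big).$$ **The sets $\mu^\dagger(\varphi)$.** For $\dagger\in\{fin,inf\}$ define finite sets of minterms recursively: - $\mu^\dagger(\bot)=\emptyset$; $\mu^\dagger(\top)=\{|h|\ge0\wedge|h|<\infty\}$; $\mu^\dagger(\mathsf{emp})=\{|h|\ge0\wedge|h|<1\}$; $\mu^\dagger(x\approx y)=\{x\approx y\wedge|h|\ge0\wedge|h|<\infty\}$; $\mu^\dagger(x\mapsto\vec y)=\{x\hookrightarrow\vec y\wedge|h|\ge1\wedge|h|<2\}$; - $\mu^\dagger(\varphi_1\wedge\varphi_2)=\bigcup\{[M_1,M_2]\mid M_i\in\mu^\dagger(\varphi_i)\}$; - $\mu^\dagger(\neg\varphi_1)=\bigcup\{\mathrm{mt}(\overline{\ell_1},\dots,\overline{\ell_n})\mid\ell_i\in M_i\}$ where $\mu^\dagger(\varphi_1)=\{M_1,\dots,M_n\}$ and $\neg\varphi_1$ is not of the form $\psi_1\multimap\psi_2$;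 - $\mu^\dagger(\varphi_1*\varphi_2)$ is the union of the sets $\mathrm{mt}(\mathrm{elim}_*(P_1,P_2))$ over all $M_i\in\mu^\dagger(\varphi_i)$, $N_j\in M_j^{E}$, $P_j\in N_j^{N_{3-j}^p}$, where $E=\{x\approx y\mid x,y\in\mathrm{fv}(M_1\cup M_2)\}$, such that $P_1,P_2$ are footprint-consistent and E-complete for $\mathrm{fv}(P_1\cup P_2)$ and $\widehat{P_1^p}=\widehat{P_2^p}$; - $\mu^\dagger(\varphi_1\multimap\varphi_2)$ is the union of the sets $\mathrm{mt}(\mathrm{elim}^\dagger_\multimap(Q_1,N_2))$ over all $M_i\in\mu^\dagger(\varphi_i)$, $N_j\in M_j^{E}$, $P_1\in N_1^{A}$, $Q_1\in P_1^{M_2^a\cup M_2^p}$, where $E$ is as before and $A=\{\mathsf{alloc}(x)\mid x\in\mathrm{fv}(M_1\cup M_2)\}$, such that $Q_1,N_2$ are footprint-consistent and E-complete for $\mathrm{fv}(Q_1\cup N_2)$, $Q_1$ is A-complete for it, $N_2^a\cup N_2^p\subseteq\widehat{Q_1^a\cup Q_1^p}$ and $\mathrm{fp}_a(Q_1)\cap\overline{N_2}=\emptyset$;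 - any other $\varphi_1\mathrel{-\!\!*}\varphi_2$ is treated as $\neg(\varphi_1\multimap\neg\varphi_2)$, i.e. the clause for negation is applied to $\mu^\dagger(\varphi_1\multimap\neg\varphi_2)$, computed from $\mu^\dagger(\varphi_1)$ and $\mu^\dagger(\neg\varphi_2)$. **Lemma.** For every quantifier-free $\mathsf{SL}^k$ formula $\varphi$, $$\text{(1)}\quad\varphi\equiv^{fin}\bigvee_{M\in\mu^{fin}(\varphi)}M\qquad\text{and}\qquad\text{(2)}\quad\varphi\equiv^{inf}\bigvee_{M\in\mu^{inf}(\varphi)}M .$$ -/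

import Mathlib

universe u v

namespace SepLog

/-! ### Syntax and semantics of quantifier-free separation logic with `k` record fields -/

/-- Quantifier-free formulae over heaps with `k` record fields and variables in `V`. -/
inductive Formula (k : ℕ) (V : Type v) : Type v
  | bot : Formula k V
  | top : Formula k V
  | emp : Formula k V
  | eq (x y : V) : Formula k V
  | pto (x : V) (y : Fin k → V) : Formula k V
  | and (φ ψ : Formula k V) : Formula k V
  | neg (φ : Formula k V) : Formula k V
  | star (φ ψ : Formula k V) : Formula k V
  | wand (φ ψ : Formula k V) : Formula k V

namespace Formula

variable {k : ℕ} {V : Type v}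

/-- Disjunction, `¬(¬φ ∧ ¬ψ)`. -/
def or (φ ψ : Formula k V) : Formula k V := neg (and (neg φ) (neg ψ))

/-- Septraction, `¬(φ -* ¬ψ)`. -/
def sept (φ ψ : Formula k V) : Formula k V := neg (wand φ (neg ψ))

/-- Conjunction of a finite list of formulae (`⊤` for the empty list). -/
def conj (l : List (Formula k V)) : Formula k V := l.foldr and top

/-- Disjunction of a finite list of formulae (`⊥` for the empty list). -/
def disj (l : List (Formula k V)) : Formula k V := l.foldr or bot

/-- The formula `|h| ≥ n`, for a natural number `n`. -/
def heapGe : ℕ → Formula k V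
  | 0 => top
  | n + 1 => star (heapGe n) (neg emp)

/-- A weight for formulae, used only to justify a recursion. -/
def weight : Formula k V → ℕ
  | bot => 1
  | top => 1
  | emp => 1
  | eq _ _ => 1
  | pto _ _ => 1
  | and φ ψ => φ.weight + ψ.weight + 1
  | neg φ => φ.weight + 1
  | star φ ψ => φ.weight + ψ.weight + 1
  | wand φ ψ => φ.weight + ψ.weight + 2

end Formula

/-- Heaps: finite partial functions from `U` to `U ^ k`. -/
@[ext]
structure Heap (k : ℕ) (U : Type u) where
  /-- the partial function -/
  map : U → Option (Fin k → U)
  finite_dom : {l | map l ≠ none}.Finite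

namespace Heap

variable {k : ℕ} {U : Type u}

/-- The domain of a heap. -/
def dom (h : Heap k U) : Set U := {l | h.map l ≠ none}

/-- The empty heap. -/
def empty : Heap k U := ⟨fun _ => none, by simp⟩

/-- Two heaps are disjoint when their domains are. -/
def Disj (h₁ h₂ : Heap k U) : Prop := Disjoint h₁.dom h₂.dom

/-- The union of two heaps (meant for disjoint ones). -/
def union (h₁ h₂ : Heap k U) : Heap k U :=
  ⟨fun l => (h₁.map l).or (h₂.map l),
    (h₁.finite_dom.union h₂.finite_dom).subset (by
      intro l hl
      by_cases h : h₁.map l = none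
      · exact Or.inr (by simpa [h] using hl)
      · exact Or.inl h)⟩

end Heap

/-- The satisfaction relation `(U, s, h) ⊨ φ`. -/
def Sat {k : ℕ} {V : Type v} {U : Type u} (s : V → U) : Heap k U → Formula k V → Prop
  | _, .bot => False
  | _, .top => True
  | h, .emp => h = Heap.empty
  | _, .eq x y => s x = s y
  | h, .pto x y => ∀ l t, h.map l = some t ↔ l = s x ∧ t = fun i => s (y i)
  | h, .and φ ψ => Sat s h φ ∧ Sat s h ψ
  | h, .neg φ => ¬ Sat s h φ
  | h, .star φ ψ => ∃ h₁ h₂ : Heap k U, h₁.Disj h₂ ∧ h = h₁.union h₂ ∧ Sat s h₁ φ ∧ Sat s h₂ ψ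
  | h, .wand φ ψ => ∀ h' : Heap k U, h'.Disj h → Sat s h' φ → Sat s (h'.union h) ψ

/-- Equivalence over all structures with a finite universe. -/
def EquivFin {k : ℕ} {V : Type v} (φ ψ : Formula k V) : Prop :=
  ∀ (U : Type u) [Nonempty U] [Finite U] (s : V → U) (h : Heap k U), Sat s h φ ↔ Sat s h ψ

/-- Equivalence over all structures with an infinite universe. -/
def EquivInf {k : ℕ} {V : Type v} (φ ψ : Formula k V) : Prop :=
  ∀ (U : Type u) [Infinite U] (s : V → U) (h : Heap k U), Sat s h φ ↔ Sat s h ψ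

/-! ### Test formulae, literals and minterms -/

/-- The test formulae `x ≈ y`, `alloc(x)` and `x ↪ y`, which carry no integer parameter. -/
inductive Atom (k : ℕ) (V : Type v) : Type v
  | eq (x y : V) : Atom k V
  | alloc (x : V) : Atom k V
  | pto (x : V) (y : Fin k → V) : Atom k V
  deriving DecidableEq

/-- Test formulae. -/
inductive Test (k : ℕ) (V : Type v) : Type v
  /-- `x ≈ y`, `alloc(x)` or `x ↪ y` -/
  | atom (a : Atom k V) : Test k V
  /-- `|h| ≥ n` -/
  | heapGe (n : ℕ) : Test k V
  /-- `|h| ≥ ∞` -/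
  | heapGeInf : Test k V
  /-- `|U| ≥ n` -/
  | univGe (n : ℕ) : Test k V
  /-- `|h| ≥ |U| - n` -/
  | heapGeUniv (n : ℕ) : Test k V

/-- The separation logic formula that an atom stands for. -/
def Atom.toFormula {k : ℕ} {V : Type v} : Atom k V → Formula k V
  | .eq x y => .eq x y
  | .alloc x => .wand (.pto x fun _ => x) .bot
  | .pto x y => .star (.pto x y) .top

/-- The separation logic formula that a test formula stands for. -/
def Test.toFormula {k : ℕ} {V : Type v} : Test k V → Formula k V
  | .atom a => a.toFormula
  | .heapGe n => .heapGe n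
  | .heapGeInf => .bot
  | .univGe n => .sept .top (.heapGe n)
  | .heapGeUniv n => .wand (.heapGe (n + 1)) .bot

/-- Literals: atoms and their negations. -/
inductive Literal (α : Type v) : Type v
  | pos (a : α) : Literal α
  | neg (a : α) : Literal α
  deriving DecidableEq

namespace Literal

/-- The complement of a literal. -/
def compl {α : Type v} : Literal α → Literal α
  | pos a => neg a
  | neg a => pos a

/-- The underlying atom of a literal. -/
def atom {α : Type v} : Literal α → α
  | pos a => a
  | neg a => a

/-- Change of atoms. -/
def map {α β : Type v} (f : α → β) : Literal α → Literal β
  | pos a => pos (f a)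
  | neg a => neg (f a)

/-- The separation logic formula that a literal stands for. -/
def toFormula {k : ℕ} {V : Type v} : Literal (Test k V) → Formula k V
  | pos t => t.toFormula
  | neg t => .neg t.toFormula

end Literal

/-- A bound on the size of the heap: `n` or `|U| - n`. -/
inductive Bound
  | num (n : ℕ) : Bound
  | univSub (n : ℕ) : Bound

/-- The test formula `|h| ≥ b`. -/
def Bound.test {k : ℕ} {V : Type v} : Bound → Test k V
  | num n => .heapGe n
  | univSub n => .heapGeUniv n

/-- A minterm: a finite set `core` of literals over the atoms `x ≈ y`, `alloc(x)`, `x ↪ y`, at most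
one literal `|U| ≥ n` and at most one literal `|U| < n`, exactly one literal `|h| ≥ hMin` and exactly
one literal `|h| < hMax`, where `hMax = none` stands for `∞`. -/
structure Minterm (k : ℕ) (V : Type v) where
  core : Finset (Literal (Atom k V))
  uLo : Option ℕ
  uHi : Option ℕ
  hMin : Bound
  hMax : Option Bound

namespace Minterm

variable {k : ℕ} {V : Type v}

/-- The literals of a minterm. -/
noncomputable def literals (M : Minterm k V) : List (Literal (Test k V)) :=
  M.core.toList.map (Literal.map Test.atom)
    ++ M.uLo.toList.map (fun n => .pos (.univGe n))
    ++ M.uHi.toList.map (fun n => .neg (.univGe n))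
    ++ [.pos M.hMin.test,
        .neg (match M.hMax with
          | none => .heapGeInf
          | some b => b.test)]

/-- A minterm, as the conjunction of its literals. -/
noncomputable def toFormula (M : Minterm k V) : Formula k V :=
  .conj (M.literals.map Literal.toFormula)

/-- The minterm `|h| ≥ 0 ∧ |h| < ∞`. -/
def trivial : Minterm k V := ⟨∅, none, none, .num 0, none⟩

end Minterm

/-! ### Conjunctions and negations of minterms -/

section Conjunction

variable {k : ℕ} {V : Type v}

/-- The conjunction of `|h| ≥ b₁` and `|h| ≥ b₂`, as a list of triples `(b, n, m)` that stand for
`|h| ≥ b ∧ |U| ≥ n ∧ |U| < m`; `none` means that the literal on `|U|` is absent. -/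
def minConj : Bound → Bound → List (Bound × Option ℕ × Option ℕ)
  | .num a, .num b => [(.num (max a b), none, none)]
  | .num a, .univSub m =>
      [(.num a, none, some (a + m + 1)), (.univSub m, some (a + m + 1), none)]
  | .univSub m, .num a =>
      [(.num a, none, some (a + m + 1)), (.univSub m, some (a + m + 1), none)]
  | .univSub m, .univSub n => [(.univSub (min m n), none, none)]

/-- The conjunction of `|h| < b₁` and `|h| < b₂`, in the same format. -/
def maxConj : Option Bound → Option Bound → List (Option Bound × Option ℕ × Option ℕ)
  | none, b => [(b, none, none)]
  | some b, none => [(some b, none, none)]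
  | some (.num a), some (.num b) => [(some (.num (min a b)), none, none)]
  | some (.num a), some (.univSub m) =>
      [(some (.num a), some (a + m), none), (some (.univSub m), none, some (a + m))]
  | some (.univSub m), some (.num a) =>
      [(some (.num a), some (a + m), none), (some (.univSub m), none, some (a + m))]
  | some (.univSub m), some (.univSub n) => [(some (.univSub (max m n)), none, none)]

variable [DecidableEq V]

/-- The minterms whose disjunction is the conjunction of two minterms. Among several literals
`|U| ≥ n` (or `|U| < n`) only the strongest is kept. -/
def mintermConj (M₁ M₂ : Minterm k V) : List (Minterm k V) :=
  (minConj M₁.hMin M₂.hMin).flatMap fun p =>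
    (maxConj M₁.hMax M₂.hMax).map fun q =>
      { core := M₁.core ∪ M₂.core
        uLo := (M₁.uLo.merge max M₂.uLo).merge max (p.2.1.merge max q.2.1)
        uHi := (M₁.uHi.merge min M₂.uHi).merge min (p.2.2.merge min q.2.2)
        hMin := p.1
        hMax := q.1 }

/-- The minterm that is equivalent to a literal, obtained by adding the missing ones of `|h| ≥ 0`
and `|h| < ∞`. The literal `|h| ≥ ∞` is false and yields no minterm. -/
def mintermOf : Literal (Test k V) → List (Minterm k V)
  | .pos (.atom a) => [⟨{.pos a}, none, none, .num 0, none⟩]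
  | .neg (.atom a) => [⟨{.neg a}, none, none, .num 0, none⟩]
  | .pos (.univGe n) => [⟨∅, some n, none, .num 0, none⟩]
  | .neg (.univGe n) => [⟨∅, none, some n, .num 0, none⟩]
  | .pos (.heapGe n) => [⟨∅, none, none, .num n, none⟩]
  | .neg (.heapGe n) => [⟨∅, none, none, .num 0, some (.num n)⟩]
  | .pos (.heapGeUniv n) => [⟨∅, none, none, .univSub n, none⟩]
  | .neg (.heapGeUniv n) => [⟨∅, none, none, .num 0, some (.univSub n)⟩]
  | .pos .heapGeInf => []
  | .neg .heapGeInf => [Minterm.trivial]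

/-- The minterms whose disjunction is a conjunction of literals. -/
def mintermsOfClause : List (Literal (Test k V)) → List (Minterm k V)
  | [] => [Minterm.trivial]
  | l :: ls =>
      ls.foldl (fun S l' => S.flatMap fun M => (mintermOf l').flatMap fun N => mintermConj M N)
        (mintermOf l)

/-- The minterms of a conjunction of two disjunctions of minterms. -/
def andMinterms (S T : List (Minterm k V)) : List (Minterm k V) :=
  S.flatMap fun M => T.flatMap fun N => mintermConj M N

/-- The minterms of the negation of a disjunction of minterms: one literal is chosen from each
minterm (this is what `List.sections` enumerates), and the complements of the chosen literals
are conjoined. -/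
noncomputable def negMinterms (S : List (Minterm k V)) : List (Minterm k V) :=
  ((S.map Minterm.literals).sections).flatMap fun ls => mintermsOfClause (ls.map Literal.compl)

end Conjunction

/-! ### Boolean combinations of test formulae and disjunctive normal form -/

/-- Boolean combinations of elements of `α`. -/
inductive BoolComb (α : Type v) : Type v
  | bot : BoolComb α
  | top : BoolComb α
  | atom (a : α) : BoolComb α
  | and (f g : BoolComb α) : BoolComb α
  | neg (f : BoolComb α) : BoolComb α

namespace BoolComb

/-- Implication. -/
def imp {α : Type v} (f g : BoolComb α) : BoolComb α := neg (and f (neg g))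

/-- Conjunction of a finite list. -/
def conj {α : Type v} (l : List (BoolComb α)) : BoolComb α := l.foldr and top

/-- A literal as a boolean combination. -/
def ofLiteral {α : Type v} : Literal α → BoolComb α
  | .pos a => atom a
  | .neg a => neg (atom a)

/-- The clauses of a disjunctive normal form of `f` (for `true`) and of `¬ f` (for `false`). -/
def dnfAux {α : Type v} : Bool → BoolComb α → List (List (Literal α))
  | true, bot => []
  | false, bot => [[]]
  | true, top => [[]]
  | false, top => []
  | true, atom a => [[.pos a]]
  | false, atom a => [[.neg a]]
  | true, and f g => (dnfAux true f).flatMap fun c => (dnfAux true g).map fun d => c ++ d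
  | false, and f g => dnfAux false f ++ dnfAux false g
  | b, neg f => dnfAux (!b) f

/-- The clauses of a disjunctive normal form of `f`. -/
def dnf {α : Type v} (f : BoolComb α) : List (List (Literal α)) := dnfAux true f

/-- The minterms of a boolean combination of test formulae, through its disjunctive normal form. -/
def minterms {k : ℕ} {V : Type v} [DecidableEq V] (f : BoolComb (Test k V)) :
    List (Minterm k V) :=
  f.dnf.flatMap mintermsOfClause

end BoolComb

section Arithmetic

variable {k : ℕ} {V : Type v}

/-- `|U| ≥ n`. -/
def univGe (n : ℕ) : BoolComb (Test k V) := .atom (.univGe n)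

/-- `|U| < n`. -/
def univLt (n : ℕ) : BoolComb (Test k V) := .neg (univGe n)

/-- `|U| ≈ n`. -/
def univEq (n : ℕ) : BoolComb (Test k V) := .and (univGe n) (univLt (n + 1))

/-- `⊤` if `p` holds and `⊥` otherwise. -/
def truth (p : Prop) [Decidable p] : BoolComb (Test k V) := if p then .top else .bot

/-- `|h| ≥ α · |U| + β`, where the pair `t` is `(α, β)`. -/
def heapGeLin (t : ℤ × ℤ) : BoolComb (Test k V) :=
  if t.1 = 0 then .atom (.heapGe t.2.toNat)
  else if t.1 = 1 then
    if t.2 ≤ 0 then .atom (.heapGeUniv (-t.2).toNat) else .bot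
  else if 1 < t.1 then
    if 0 < t.2 then .bot
    else
      let N := (-t.2 / (t.1 - 1)).toNat
      .and (univLt (N + 1)) (.conj ((List.range N).map fun i =>
        (univEq (i + 1)).imp (.atom (.heapGe (t.1 * (i + 1) + t.2).toNat))))
  else if t.2 < 0 then .top
  else
    .conj ((List.range (t.2 / -t.1).toNat).map fun i =>
      (univEq (i + 1)).imp (.atom (.heapGe (t.1 * (i + 1) + t.2).toNat)))

/-- `|h| < α · |U| + β`, where the pair `t` is `(α, β)`. -/
def heapLtLin (t : ℤ × ℤ) : BoolComb (Test k V) := .neg (heapGeLin t)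

/-- A bound as a pair `(α, β)` that stands for `α · |U| + β`. -/
def Bound.lin : Bound → ℤ × ℤ
  | num n => (0, n)
  | univSub n => (1, -n)

/-- `c < b`, where `b = none` stands for `∞`. -/
def numLt (c : ℕ) : Option Bound → BoolComb (Test k V)
  | none => .top
  | some (.num n) => truth (c < n)
  | some (.univSub n) => univGe (c + n + 1)

/-- `|U| ≥ b + c`. -/
def univGeAdd : Bound → ℕ → BoolComb (Test k V)
  | .num n, c => univGe (n + c)
  | .univSub n, c => truth (c ≤ n)

/-- `|h| < b₁ + b₂ - 1`. -/
def heapLtAddSubOne : Option Bound → Option Bound → BoolComb (Test k V)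
  | some b₁, some b₂ => heapLtLin (b₁.lin + b₂.lin - (0, 1))
  | _, _ => .top

/-- `|h| ≥ b₁ - b₂ + 1`. -/
def heapGeSubAddOne (b₁ : Bound) : Option Bound → BoolComb (Test k V)
  | some b₂ => heapGeLin (b₁.lin - b₂.lin + (0, 1))
  | none => .top

/-- `|h| < b₁ - b₂`. -/
def heapLtSub : Option Bound → Bound → BoolComb (Test k V)
  | some b₁, b₂ => heapLtLin (b₁.lin - b₂.lin)
  | none, _ => .top

end Arithmetic

/-! ### Notions attached to a set of literals -/

section LiteralSets

variable {k : ℕ} {V : Type v}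

/-- The equivalence relation `x ≈_T y`: the equality of `x` and `y` follows from the equalities
in `T`. -/
def eqvSetoid (T : Finset (Literal (Atom k V))) : Setoid V :=
  Relation.EqvGen.setoid fun x y => Literal.pos (Atom.eq x y) ∈ T

/-- `x ≈_T y`. -/
def Eqv (T : Finset (Literal (Atom k V))) (x y : V) : Prop := (eqvSetoid T).r x y

/-- `x ≉_T y`: the literal `¬ x ≈ y` follows from the equalities and disequalities in `T`. -/
def NotEqv (T : Finset (Literal (Atom k V))) (x y : V) : Prop :=
  ∃ x' y', Eqv T x x' ∧ Eqv T y y' ∧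
    (Literal.neg (Atom.eq x' y') ∈ T ∨ Literal.neg (Atom.eq y' x') ∈ T)

/-- The number `|X|_T` of classes of `≈_T` that meet `X`. -/
noncomputable def classCount (T : Finset (Literal (Atom k V))) (X : Finset V) : ℕ :=
  ((fun x => Quotient.mk (eqvSetoid T) x) '' (X : Set V)).ncard

/-- The address of an atom about the heap. -/
def Atom.addr? : Atom k V → Option V
  | .eq _ _ => none
  | .alloc x => some x
  | .pto x _ => some x

/-- The atom is an equality. -/
def Atom.isEq : Atom k V → Bool
  | .eq _ _ => true
  | _ => false

/-- The atom is of the form `alloc(x)`. -/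
def Atom.isAlloc : Atom k V → Bool
  | .alloc _ => true
  | _ => false

/-- The atom is of the form `x ↪ y`. -/
def Atom.isPto : Atom k V → Bool
  | .pto _ _ => true
  | _ => false

variable [DecidableEq V]

/-- The variables of an atom. -/
def Atom.vars : Atom k V → Finset V
  | .eq x y => {x, y}
  | .alloc x => {x}
  | .pto x y => insert x (Finset.univ.image y)

/-- The variables of a set of literals. -/
def fv (T : Finset (Literal (Atom k V))) : Finset V := T.biUnion fun l => l.atom.vars

open Classical in
/-- The variables that are allocated in every model of `T`. -/
noncomputable def avar (T : Finset (Literal (Atom k V))) : Finset V :=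
  (fv T).filter fun x => ∃ x', Eqv T x x' ∧
    (Literal.pos (Atom.alloc x') ∈ T ∨ ∃ y, Literal.pos (Atom.pto x' y) ∈ T)

open Classical in
/-- The variables that are allocated in no model of `T`. -/
noncomputable def nvar (T : Finset (Literal (Atom k V))) : Finset V :=
  (fv T).filter fun x => ∃ x', Eqv T x x' ∧ Literal.neg (Atom.alloc x') ∈ T

/-- The footprint of `T` relative to `X`: the literals of `T` of the form `alloc(x)`, `¬alloc(x)`,
`x ↪ y`, `¬ x ↪ y` with `x ∈ X`. -/
def footprint (X : Finset V) (T : Finset (Literal (Atom k V))) : Finset (Literal (Atom k V)) :=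
  T.filter fun l => ∃ x ∈ X, l.atom.addr? = some x

/-- The footprint of `T` relative to its allocated variables. -/
noncomputable def aFootprint (T : Finset (Literal (Atom k V))) : Finset (Literal (Atom k V)) :=
  footprint (avar T) T

/-- The number of classes of `≈_T` of allocated variables. -/
noncomputable def allocNo (T : Finset (Literal (Atom k V))) : ℕ := classCount T (avar T)

/-- The number of classes of `≈_T` of variables from `X` that are never allocated. -/
noncomputable def nallocNo (X : Finset V) (T : Finset (Literal (Atom k V))) : ℕ :=
  classCount T (X ∩ nvar T)

/-- The number of tuples `y`, up to componentwise `≈_T`, with `¬ x' ↪ y ∈ T` for some `x' ≈_T x`. -/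
noncomputable def dataNo (x : V) (T : Finset (Literal (Atom k V))) : ℕ :=
  ((fun (y : Fin k → V) (i : Fin k) => Quotient.mk (eqvSetoid T) (y i)) ''
    {y | ∃ x', Eqv T x x' ∧ Literal.neg (Atom.pto x' y) ∈ T}).ncard

/-- The literals of `T` over equalities. -/
def eqPart (T : Finset (Literal (Atom k V))) : Finset (Literal (Atom k V)) :=
  T.filter fun l => l.atom.isEq = true

/-- The literals of `T` over `alloc`. -/
def allocPart (T : Finset (Literal (Atom k V))) : Finset (Literal (Atom k V)) :=
  T.filter fun l => l.atom.isAlloc = true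

/-- The literals of `T` over points-to. -/
def ptoPart (T : Finset (Literal (Atom k V))) : Finset (Literal (Atom k V)) :=
  T.filter fun l => l.atom.isPto = true

/-- The set of complements of the literals of `T`. -/
def complSet (T : Finset (Literal (Atom k V))) : Finset (Literal (Atom k V)) :=
  T.image Literal.compl

/-- The complement closure of `T`. -/
def complClosure (T : Finset (Literal (Atom k V))) : Finset (Literal (Atom k V)) :=
  T ∪ complSet T

/-- Exactly one of `x ≈ y`, `¬ x ≈ y` belongs to `T`, for all `x, y ∈ X`. -/
def EComplete (T : Finset (Literal (Atom k V))) (X : Finset V) : Prop :=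
  ∀ x ∈ X, ∀ y ∈ X, Xor (Literal.pos (Atom.eq x y) ∈ T) (Literal.neg (Atom.eq x y) ∈ T)

/-- Exactly one of `alloc(x)`, `¬alloc(x)` belongs to `T`, for all `x ∈ X`. -/
def AComplete (T : Finset (Literal (Atom k V))) (X : Finset V) : Prop :=
  ∀ x ∈ X, Xor (Literal.pos (Atom.alloc x) ∈ T) (Literal.neg (Atom.alloc x) ∈ T)

/-- Footprint-consistency. -/
def FootprintConsistent (T : Finset (Literal (Atom k V))) : Prop :=
  ∀ (x x' : V) (y y' : Fin k → V), Eqv T x x' → (∀ i, Eqv T (y i) (y' i)) →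
    (Literal.pos (Atom.alloc x) ∈ T → Literal.neg (Atom.alloc x') ∉ T) ∧
    (Literal.pos (Atom.pto x y) ∈ T →
      Literal.neg (Atom.alloc x') ∉ T ∧ Literal.neg (Atom.pto x' y') ∉ T)

/-- The points-to literals of `T` contradict the functionality of the heap. -/
def PtoConflict (T : Finset (Literal (Atom k V))) : Prop :=
  ∃ (x x' : V) (y y' : Fin k → V), Literal.pos (Atom.pto x y) ∈ T ∧
    Literal.pos (Atom.pto x' y') ∈ T ∧ Eqv T x x' ∧ ∃ i, NotEqv T (y i) (y' i)

/-- The equalities `x ≈ y` with `x, y ∈ X`. -/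
def eqs (X : Finset V) : Finset (Literal (Atom k V)) :=
  (X ×ˢ X).image fun p => .pos (.eq p.1 p.2)

/-- The literals `alloc(x)` with `x ∈ X`. -/
def allocs (X : Finset V) : Finset (Literal (Atom k V)) :=
  X.image fun x => .pos (.alloc x)

/-- The completions of a minterm by a set `L` of literals: for each `B ⊆ L`, the literals of `B` and
the complements of those of `L \ B` are added. -/
noncomputable def completions (M : Minterm k V) (L : Finset (Literal (Atom k V))) :
    List (Minterm k V) :=
  L.powerset.toList.map fun B => { M with core := M.core ∪ (B ∪ complSet (L \ B)) }

end LiteralSets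

/-! ### Elimination of the separating connectives between minterms -/

section Elimination

variable {k : ℕ} {V : Type v}

/-- The conjunction of a set of literals. -/
noncomputable def conjLits (T : Finset (Literal (Atom k V))) : BoolComb (Test k V) :=
  .conj (T.toList.map fun l => .ofLiteral (l.map Test.atom))

/-- The conjunction of `alloc(x)` for `x ∈ X`. -/
noncomputable def allocAll (X : Finset V) : BoolComb (Test k V) :=
  .conj (X.toList.map fun x => .atom (.atom (.alloc x)))

/-- The conjunction of `¬alloc(x)` for `x ∈ X`. -/
noncomputable def nallocAll (X : Finset V) : BoolComb (Test k V) :=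
  .conj (X.toList.map fun x => .neg (.atom (.atom (.alloc x))))

variable [DecidableEq V]

/-- The literals on `|U|` of the domain closure of `M` (`⊥` if the domain closure is `⊥`). The number
`sInf {m | n ≤ m ^ k}` is the `k`-th root of `n`, rounded up. -/
noncomputable def domClosureU (M : Minterm k V) : BoolComb (Test k V) :=
  .conj (M.uLo.toList.map univGe ++ M.uHi.toList.map univLt ++
    [univGe (sInf {m : ℕ | ((avar M.core).sup fun x => dataNo x M.core + 1) ≤ m ^ k}),
     match M.hMin, M.hMax with
     | .num n₁, some (.num n₂) => truth (n₁ < n₂)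
     | .num n₁, some (.univSub n₂) => univGe (n₁ + n₂ + 1)
     | .univSub n₁, some (.num n₂) => univLt (n₁ + n₂)
     | .univSub n₁, some (.univSub n₂) => truth (n₂ < n₁)
     | _, none => .top])

open Classical in
/-- The equality literals of the points-to closure of `M` (`⊥` if the points-to closure is `⊥`). -/
noncomputable def ptoClosureE (M : Minterm k V) : BoolComb (Test k V) :=
  if PtoConflict M.core then .bot else conjLits (eqPart M.core)

open Classical in
/-- The negative points-to literals common to `M₁` and `M₂`, on unallocated variables. -/
noncomputable def negPto (M₁ M₂ : Minterm k V) : Finset (Literal (Atom k V)) :=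
  (M₁.core ∩ M₂.core).filter fun l =>
    ∃ x y, l = .neg (.pto x y) ∧ x ∉ avar (M₁.core ∪ M₂.core)

/-- The formula `η` of a pair of minterms. -/
noncomputable def etaStar (M₁ M₂ : Minterm k V) : BoolComb (Test k V) :=
  .conj ((nvar M₂.core \ avar M₁.core).powerset.toList.map fun Y =>
    (allocAll Y).imp
      (.and
        (heapGeLin ((0, ((allocNo M₁.core + classCount M₁.core Y : ℕ) : ℤ)) + M₂.hMin.lin))
        (numLt (allocNo M₁.core + classCount M₁.core Y) M₁.hMax)))

/-- The boolean combination of test formulae that is equivalent to `M₁ * M₂`. -/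
noncomputable def elimStar (M₁ M₂ : Minterm k V) : BoolComb (Test k V) :=
  .conj
    [conjLits (eqPart M₁.core), conjLits (eqPart M₂.core), domClosureU M₁, domClosureU M₂,
     .conj ((avar M₁.core ×ˢ avar M₂.core).toList.map fun p => .neg (.atom (.atom (.eq p.1 p.2)))),
     conjLits (aFootprint M₁.core), conjLits (aFootprint M₂.core),
     nallocAll (nvar M₁.core ∩ nvar M₂.core), conjLits (negPto M₁ M₂),
     heapGeLin (M₁.hMin.lin + M₂.hMin.lin), heapLtAddSubOne M₁.hMax M₂.hMax,
     etaStar M₁ M₂, etaStar M₂ M₁]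

/-- The hypotheses under which `elimStar` is used. -/
def StarReady (M₁ M₂ : Minterm k V) : Prop :=
  FootprintConsistent M₁.core ∧ FootprintConsistent M₂.core ∧
  EComplete M₁.core (fv (M₁.core ∪ M₂.core)) ∧ EComplete M₂.core (fv (M₁.core ∪ M₂.core)) ∧
  complClosure (ptoPart M₁.core) = complClosure (ptoPart M₂.core)

/-- The two kinds of universe. -/
inductive UnivKind
  | fin
  | inf

/-- The formula `λ`; it is `⊤` for infinite universes. -/
noncomputable def lambdaSept (d : UnivKind) (M₁ M₂ : Minterm k V) : BoolComb (Test k V) :=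
  match d with
  | .inf => .top
  | .fin => .conj ((fv (M₁.core ∪ M₂.core)).powerset.toList.map fun Y =>
      (nallocAll Y).imp
        (.and
          (heapLtLin ((1, 0) - M₁.hMin.lin - (0, (nallocNo Y M₁.core : ℤ)) + (0, 1)))
          (univGeAdd M₂.hMin (nallocNo Y M₁.core))))

/-- The boolean combination of test formulae that is equivalent to the septraction of `M₁` and
`M₂`. Its last two conjuncts, `#ₐ(M₁) < max M₁` and `|h| < max M₂ - #ₐ(M₁)`, leave room for the
variables that `M₁` allocates. -/
noncomputable def elimSept (d : UnivKind) (M₁ M₂ : Minterm k V) : BoolComb (Test k V) :=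
  .conj
    [ptoClosureE M₁, conjLits (eqPart M₂.core), domClosureU M₁, domClosureU M₂,
     nallocAll (avar M₁.core), conjLits (footprint (nvar M₁.core) M₂.core),
     heapGeSubAddOne M₂.hMin M₁.hMax, heapLtSub M₂.hMax M₁.hMin,
     lambdaSept d M₁ M₂,
     numLt (allocNo M₁.core) M₁.hMax, heapLtSub M₂.hMax (.num (allocNo M₁.core))]

/-- The hypotheses under which `elimSept` is used. -/
def SeptReady (M₁ M₂ : Minterm k V) : Prop :=
  FootprintConsistent M₁.core ∧ FootprintConsistent M₂.core ∧
  EComplete M₁.core (fv (M₁.core ∪ M₂.core)) ∧ EComplete M₂.core (fv (M₁.core ∪ M₂.core)) ∧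
  AComplete M₁.core (fv (M₁.core ∪ M₂.core)) ∧
  allocPart M₂.core ∪ ptoPart M₂.core ⊆
    complClosure (allocPart M₁.core ∪ ptoPart M₁.core) ∧
  aFootprint M₁.core ∩ complSet M₂.core = ∅

open Classical in
/-- The minterms of a separating conjunction of two disjunctions of minterms. -/
noncomputable def starMinterms (S T : List (Minterm k V)) : List (Minterm k V) :=
  S.flatMap fun M₁ => T.flatMap fun M₂ =>
    (completions M₁ (eqs (fv (M₁.core ∪ M₂.core)))).flatMap fun N₁ =>
    (completions M₂ (eqs (fv (M₁.core ∪ M₂.core)))).flatMap fun N₂ =>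
    (completions N₁ (ptoPart N₂.core)).flatMap fun P₁ =>
    (completions N₂ (ptoPart N₁.core)).flatMap fun P₂ =>
      if StarReady P₁ P₂ then (elimStar P₁ P₂).minterms else []

open Classical in
/-- The minterms of a septraction of two disjunctions of minterms. -/
noncomputable def septMinterms (d : UnivKind) (S T : List (Minterm k V)) : List (Minterm k V) :=
  S.flatMap fun M₁ => T.flatMap fun M₂ =>
    (completions M₁ (eqs (fv (M₁.core ∪ M₂.core)))).flatMap fun N₁ =>
    (completions M₂ (eqs (fv (M₁.core ∪ M₂.core)))).flatMap fun N₂ =>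
    (completions N₁ (allocs (fv (M₁.core ∪ M₂.core)))).flatMap fun P₁ =>
    (completions P₁ (allocPart M₂.core ∪ ptoPart M₂.core)).flatMap fun Q₁ =>
      if SeptReady Q₁ N₂ then (elimSept d Q₁ N₂).minterms else []

/-- The finite set of minterms `μ(φ)`, given as a list. A separating implication `φ -* ψ` is treated
as `¬(φ ⊸ ¬ψ)`, where `φ ⊸ ψ` is the septraction `¬(φ -* ¬ψ)`. -/
noncomputable def mu (d : UnivKind) : Formula k V → List (Minterm k V)
  | .bot => []
  | .top => [Minterm.trivial]
  | .emp => [⟨∅, none, none, .num 0, some (.num 1)⟩]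
  | .eq x y => [⟨{.pos (.eq x y)}, none, none, .num 0, none⟩]
  | .pto x y => [⟨{.pos (.pto x y)}, none, none, .num 1, some (.num 2)⟩]
  | .and φ ψ => andMinterms (mu d φ) (mu d ψ)
  | .star φ ψ => starMinterms (mu d φ) (mu d ψ)
  | .neg (.wand φ (.neg ψ)) => septMinterms d (mu d φ) (mu d ψ)
  | .neg φ => negMinterms (mu d φ)
  | .wand φ ψ => negMinterms (septMinterms d (mu d φ) (mu d (.neg ψ)))
termination_by φ => φ.weight
decreasing_by all_goals (simp only [Formula.weight]; omega)

end Elimination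

end SepLog

namespace SepLog

/-! ### Heaps -/

namespace Heap

variable {k : ℕ} {U : Type u} {h h₁ h₂ : Heap k U} {l : U}

/-! Fix a kind of universe and a store. The theorem is `represents_mu`, proved by induction along
the recursion of `mu`, with a list of minterms read as a predicate on heaps. The induction carries
an invariant: over infinite universes no bound |U| - n ever occurs. Hence every bound is an integer
α|U| + β with `Nat.card U` in the role of |U|; for infinite U this number is the meaningless 0, but
its coefficient is then 0 as well.

Boolean connectives only need distributivity and De Morgan's law (`represents_mintermConj`,
`represents_negMinterms`). The substance lies in eliminating the two separating connectives between
minterms.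

For the separating conjunction (`holds_elimStar_iff`), splitting h means choosing the domain D of
the first part. Some locations are forced into D: the values of variables that M₁ allocates, and the
allocated values of variables that M₂ forbids. A symmetric set is forced out. The formula makes the
forced sets disjoint subsets of dom h, makes the cells agree with the literals, and compares each
lower bound on |D| with each upper bound. An admissible size then exists (`exists_between_bounds`),
and any D of that size between the forced sets will do.

For septraction (`holds_elimSept_iff`), a heap h' disjoint from h must be built. The variables that
M₁ allocates receive cells with tuples that respect its points-to literals
(`exists_admissible_tuple`); then h' is padded with locations outside h and away from the forbidden
variables (`exists_finset_disjoint`), up to the least size that the lower bounds allow. Room for the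
padding is automatic if U is infinite, and is what λ provides if U is finite.

Both eliminations need literal sets that decide all equalities, so that classes of variables
correspond to locations and syntactic counts become cardinalities (`Separates.classCount_eq`).
Completions achieve this without loss: a model of a minterm is a model of one of its completions,
and the pairs rejected by the side conditions cannot be realised together (`starReady_of_models`,
`septReady_of_models`). -/

theorem mem_dom : l ∈ h.dom ↔ h.map l ≠ none := Iff.rfl

theorem map_eq_none : h.map l = none ↔ l ∉ h.dom := by simp [dom]

theorem mem_dom_of_map_eq_some {t : Fin k → U} (e : h.map l = some t) : l ∈ h.dom := by
  simp [mem_dom, e]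

theorem dom_finite (h : Heap k U) : h.dom.Finite := h.finite_dom

/-- The number of allocated locations. -/
noncomputable def card (h : Heap k U) : ℕ := h.dom.ncard

theorem dom_empty : (empty : Heap k U).dom = ∅ := by
  ext l; simp [mem_dom, empty]

theorem eq_empty_iff : h = empty ↔ h.dom = ∅ := by
  constructor
  · rintro rfl; exact dom_empty
  · intro e
    ext1; funext l
    have : l ∉ h.dom := by simp [e]
    simpa [empty] using map_eq_none.2 this

theorem eq_empty_iff_card : h = empty ↔ h.card = 0 := by
  rw [eq_empty_iff, card, Set.ncard_eq_zero h.dom_finite]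

theorem dom_union : (h₁.union h₂).dom = h₁.dom ∪ h₂.dom := by
  ext l
  cases e : h₁.map l <;> simp [mem_dom, union, e]

theorem union_map_of_notMem_left (hl : l ∉ h₁.dom) : (h₁.union h₂).map l = h₂.map l := by
  simp [union, map_eq_none.2 hl]

theorem union_map_of_notMem_right (hl : l ∉ h₂.dom) : (h₁.union h₂).map l = h₁.map l := by
  simp [union, map_eq_none.2 hl]

theorem union_map_of_mem_left (hd : h₁.Disj h₂) (hl : l ∈ h₁.dom) :
    (h₁.union h₂).map l = h₁.map l :=
  union_map_of_notMem_right fun hl' => Set.disjoint_left.1 hd hl hl'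

theorem union_map_of_mem_right (hd : h₁.Disj h₂) (hl : l ∈ h₂.dom) :
    (h₁.union h₂).map l = h₂.map l :=
  union_map_of_notMem_left fun hl' => Set.disjoint_left.1 hd hl' hl

theorem card_union (hd : h₁.Disj h₂) : (h₁.union h₂).card = h₁.card + h₂.card := by
  rw [card, dom_union, Set.ncard_union_eq hd h₁.dom_finite h₂.dom_finite]; rfl

open Classical in
/-- The restriction of a heap to a set of locations. -/
noncomputable def restrict (h : Heap k U) (D : Set U) : Heap k U :=
  ⟨fun l => if l ∈ D then h.map l else none, h.finite_dom.subset fun l hl => by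
    by_cases hD : l ∈ D <;> simp_all⟩

theorem dom_restrict (D : Set U) : (h.restrict D).dom = h.dom ∩ D := by
  ext l; by_cases hD : l ∈ D <;> simp [mem_dom, restrict, hD]

theorem restrict_map_of_mem {D : Set U} (hl : l ∈ D) : (h.restrict D).map l = h.map l := by
  simp [restrict, hl]

theorem disj_restrict_compl (D : Set U) : (h.restrict D).Disj (h.restrict Dᶜ) := by
  rw [Disj, dom_restrict, dom_restrict]
  exact Set.disjoint_left.2 fun l h₁ h₂ => h₂.2 h₁.2

theorem restrict_union_compl (D : Set U) : (h.restrict D).union (h.restrict Dᶜ) = h := by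
  ext1; funext l
  by_cases hD : l ∈ D <;> simp [union, restrict, hD]

open Classical in
/-- The heap with a given domain and given values. -/
noncomputable def ofFinset (D : Finset U) (f : U → Fin k → U) : Heap k U :=
  ⟨fun l => if l ∈ D then some (f l) else none, D.finite_toSet.subset fun l hl => by
    by_contra hD; simp_all⟩

theorem dom_ofFinset (D : Finset U) (f : U → Fin k → U) : (ofFinset D f).dom = D := by
  ext l; by_cases hD : l ∈ D <;> simp [mem_dom, ofFinset, hD]

theorem ofFinset_map_of_mem {D : Finset U} {f : U → Fin k → U} (hl : l ∈ D) :
    (ofFinset D f).map l = some (f l) := by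
  simp [ofFinset, hl]

theorem card_ofFinset (D : Finset U) (f : U → Fin k → U) : (ofFinset D f).card = D.card := by
  rw [card, dom_ofFinset, Set.ncard_coe_finset]

theorem card_le_natCard [Finite U] (h : Heap k U) : h.card ≤ Nat.card U := by
  rw [← Set.ncard_univ]; exact Set.ncard_le_ncard (Set.subset_univ _)

end Heap

/-! ### Direct semantics of literals and minterms -/

/-- The universe has at least `n` elements. -/
def UnivGe (U : Type u) (n : ℕ) : Prop := ∃ D : Finset U, n ≤ D.card

theorem univGe_of_infinite (U : Type u) [Infinite U] (n : ℕ) : UnivGe U n :=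
  let ⟨D, hD⟩ := Infinite.exists_subset_card_eq U n
  ⟨D, hD.ge⟩

theorem univGe_iff (U : Type u) [Finite U] (n : ℕ) : UnivGe U n ↔ n ≤ Nat.card U := by
  have := Fintype.ofFinite U
  rw [Nat.card_eq_fintype_card]
  exact ⟨fun ⟨D, hD⟩ => hD.trans D.card_le_univ, fun h => ⟨Finset.univ, h⟩⟩

theorem UnivGe.mono {U : Type u} {m n : ℕ} (h : UnivGe U n) (hm : m ≤ n) : UnivGe U m :=
  let ⟨D, hD⟩ := h
  ⟨D, hm.trans hD⟩

/-- The truth value of a literal, given the truth values of the atoms. -/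
def Literal.Holds {α : Type v} (p : α → Prop) : Literal α → Prop
  | pos a => p a
  | neg a => ¬ p a

theorem Literal.holds_compl {α : Type v} (p : α → Prop) (l : Literal α) :
    l.compl.Holds p ↔ ¬ l.Holds p := by
  cases l <;> simp [compl, Holds]

section Semantics

variable {k : ℕ} {V : Type v} {U : Type u}

/-- The truth value of an atom. -/
def Atom.Holds (s : V → U) (h : Heap k U) : Atom k V → Prop
  | .eq x y => s x = s y
  | .alloc x => s x ∈ h.dom
  | .pto x y => h.map (s x) = some fun i => s (y i)

/-- The truth value of a test formula. -/
def Test.Holds (s : V → U) (h : Heap k U) : Test k V → Prop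
  | .atom a => a.Holds s h
  | .heapGe n => n ≤ h.card
  | .heapGeInf => False
  | .univGe n => UnivGe U n
  | .heapGeUniv n => Finite U ∧ Nat.card U ≤ h.card + n

/-- Satisfaction of a set of literals. -/
def CoreHolds (s : V → U) (h : Heap k U) (T : Finset (Literal (Atom k V))) : Prop :=
  ∀ l ∈ T, l.Holds (Atom.Holds s h)

/-- Satisfaction of a minterm. -/
def Minterm.Models (s : V → U) (h : Heap k U) (M : Minterm k V) : Prop :=
  CoreHolds s h M.core ∧ (∀ n ∈ M.uLo, UnivGe U n) ∧ (∀ n ∈ M.uHi, ¬ UnivGe U n) ∧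
    (M.hMin.test : Test k V).Holds s h ∧ ∀ b ∈ M.hMax, ¬ (b.test : Test k V).Holds s h

theorem sat_conj (s : V → U) (h : Heap k U) (l : List (Formula k V)) :
    Sat s h (.conj l) ↔ ∀ φ ∈ l, Sat s h φ := by
  induction l with
  | nil => simp [Formula.conj, Sat]
  | cons φ l ih => simpa [Formula.conj, Sat] using fun _ => ih

theorem sat_disj (s : V → U) (h : Heap k U) (l : List (Formula k V)) :
    Sat s h (.disj l) ↔ ∃ φ ∈ l, Sat s h φ := by
  induction l with
  | nil => simp [Formula.disj, Sat]
  | cons φ l ih =>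
    have : Sat s h (.disj (φ :: l)) ↔ Sat s h φ ∨ Sat s h (.disj l) := by
      simp only [Formula.disj, List.foldr_cons, Formula.or, Sat]; tauto
    simp [this, ih]

theorem sat_sept (s : V → U) (h : Heap k U) (φ ψ : Formula k V) :
    Sat s h (.sept φ ψ) ↔
      ∃ h' : Heap k U, h'.Disj h ∧ Sat s h' φ ∧ Sat s (h'.union h) ψ := by
  simp [Formula.sept, Sat]

theorem sat_heapGe (s : V → U) (h : Heap k U) (n : ℕ) :
    Sat s h (.heapGe n) ↔ n ≤ h.card := by
  induction n generalizing h with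
  | zero => simp [Formula.heapGe, Sat]
  | succ n ih =>
    simp only [Formula.heapGe, Sat, ih]
    constructor
    · rintro ⟨h₁, h₂, hd, rfl, hn, he⟩
      rw [Heap.card_union hd]
      have : h₂.card ≠ 0 := fun e => he (Heap.eq_empty_iff_card.2 e)
      omega
    · intro hn
      obtain ⟨l, hl⟩ : h.dom.Nonempty := by
        rw [← Set.ncard_pos h.dom_finite]; exact lt_of_lt_of_le n.succ_pos hn
      -- The heap is cut into the cell at `l`, which witnesses `¬ emp`, and the rest, which has one
      -- cell fewer.
      have hc := Heap.card_union (Heap.disj_restrict_compl (h := h) {l}ᶜ)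
      have hl' : (h.restrict {l}ᶜᶜ).card = 1 := by
        rw [Heap.card, Heap.dom_restrict, compl_compl, Set.inter_eq_right.2 (by simpa using hl),
          Set.ncard_singleton]
      rw [Heap.restrict_union_compl, hl'] at hc
      refine ⟨_, _, Heap.disj_restrict_compl {l}ᶜ, (Heap.restrict_union_compl _).symm, by omega, ?_⟩
      rw [Heap.eq_empty_iff_card, hl']
      exact one_ne_zero

theorem sat_pto_iff (s : V → U) (h : Heap k U) (x : V) (y : Fin k → V) :
    Sat s h (.pto x y) ↔ h.map (s x) = some (fun i => s (y i)) ∧ h.dom = {s x} := by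
  simp only [Sat]
  constructor
  · intro H
    refine ⟨(H _ _).2 ⟨rfl, rfl⟩, ?_⟩
    ext l
    rw [Heap.mem_dom, Option.ne_none_iff_exists']
    constructor
    · rintro ⟨t, ht⟩; exact ((H l t).1 ht).1
    · rintro rfl; exact ⟨_, (H _ _).2 ⟨rfl, rfl⟩⟩
  · rintro ⟨e, hd⟩ l t
    constructor
    · intro ht
      have : l ∈ h.dom := Heap.mem_dom_of_map_eq_some ht
      rw [hd] at this
      obtain rfl : l = s x := this
      exact ⟨rfl, by simpa [e] using ht.symm⟩
    · rintro ⟨rfl, rfl⟩; exact e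

/-- For `alloc`, a wand into `⊥` denies that a disjoint heap of the given shape exists, and the
one-cell heap at `s x` can be added exactly when that location is free. -/
theorem sat_atom (s : V → U) (h : Heap k U) (a : Atom k V) :
    Sat s h a.toFormula ↔ a.Holds s h := by
  cases a with
  | eq x y => simp [Atom.toFormula, Sat, Atom.Holds]
  | alloc x =>
    rw [Atom.toFormula, Sat]
    simp only [sat_pto_iff]
    simp only [Sat, Atom.Holds]
    constructor
    · intro H
      by_contra hx
      refine H (Heap.ofFinset {s x} fun _ _ => s x) ?_ ?_
      · rw [Heap.Disj, Heap.dom_ofFinset]; simpa using hx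
      · rw [Heap.dom_ofFinset]
        exact ⟨Heap.ofFinset_map_of_mem (by simp), by simp⟩
    · rintro hx h' hd ⟨-, hh⟩
      rw [Heap.Disj, hh] at hd
      exact Set.disjoint_left.1 hd rfl hx
  | pto x y =>
    rw [Atom.toFormula, Sat]
    simp only [sat_pto_iff]
    simp only [Sat, Atom.Holds, and_true]
    constructor
    · rintro ⟨h₁, h₂, hd, rfl, e, -⟩
      rw [Heap.union_map_of_mem_left hd (Heap.mem_dom_of_map_eq_some e), e]
    · intro e
      refine ⟨_, _, Heap.disj_restrict_compl {s x}, (Heap.restrict_union_compl _).symm, ?_, ?_⟩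
      · rw [Heap.restrict_map_of_mem (Set.mem_singleton _), e]
      · rw [Heap.dom_restrict]
        simpa using Heap.mem_dom_of_map_eq_some e

theorem sat_test (s : V → U) (h : Heap k U) (t : Test k V) :
    Sat s h t.toFormula ↔ t.Holds s h := by
  cases t with
  | atom a => exact sat_atom s h a
  | heapGe n => exact sat_heapGe s h n
  | heapGeInf => rfl
  | univGe n =>
    simp only [Test.toFormula, sat_sept, sat_heapGe, Test.Holds]
    constructor
    · rintro ⟨h', -, -, hn⟩
      exact ⟨(h'.union h).dom_finite.toFinset, by
        rwa [← Set.ncard_eq_toFinset_card _ (h'.union h).dom_finite]⟩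
    · rintro ⟨D, hD⟩
      classical
      -- Allocating every free location of `D` gives a heap whose domain covers `D`; the stored
      -- tuples are irrelevant.
      refine ⟨Heap.ofFinset (D.filter (· ∉ h.dom)) fun l _ => l, ?_, trivial, hD.trans ?_⟩
      · rw [Heap.Disj, Heap.dom_ofFinset]
        exact Set.disjoint_left.2 fun l hl => by simp_all
      · rw [Heap.card, ← Set.ncard_coe_finset]
        refine Set.ncard_le_ncard ?_ (Heap.dom_finite _)
        intro l hl
        rw [Heap.dom_union, Heap.dom_ofFinset]
        by_cases hh : l ∈ h.dom
        · exact Or.inr hh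
        · exact Or.inl (by simp_all)
  | heapGeUniv n =>
    simp only [Test.toFormula, Sat, sat_heapGe, Test.Holds]
    constructor
    · intro H
      -- More than `n` free locations would carry a heap that the wand into `⊥` excludes. So the
      -- complement of the domain is finite, and U with it: this test is false over infinite
      -- universes.
      have key : ∀ D : Finset U, (D : Set U) ⊆ h.domᶜ → D.card ≤ n := by
        intro D hD
        by_contra! hn
        refine H (Heap.ofFinset D fun l _ => l) ?_ (by rw [Heap.card_ofFinset]; omega)
        rw [Heap.Disj, Heap.dom_ofFinset]
        exact Set.disjoint_left.2 hD
      have hfin : h.domᶜ.Finite := by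
        by_contra hinf
        obtain ⟨D, hD, hc⟩ := Set.Infinite.exists_subset_card_eq hinf (n + 1)
        have := key D hD
        omega
      have hU : Finite U := Set.finite_univ_iff.1 (by
        rw [← Set.union_compl_self h.dom]; exact h.dom_finite.union hfin)
      refine ⟨hU, ?_⟩
      have h₁ := key hfin.toFinset (by simp)
      rw [← Set.ncard_eq_toFinset_card _ hfin] at h₁
      have h₂ := Set.ncard_add_ncard_compl h.dom
      rw [Heap.card]; omega
    · rintro ⟨hU, hn⟩ h' hd hc
      have := (h'.union h).card_le_natCard
      rw [Heap.card_union hd] at this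
      omega

theorem sat_literal (s : V → U) (h : Heap k U) (l : Literal (Test k V)) :
    Sat s h l.toFormula ↔ l.Holds (Test.Holds s h) := by
  cases l <;> simp [Literal.toFormula, Literal.Holds, Sat, sat_test]

theorem models_iff_literals (s : V → U) (h : Heap k U) (M : Minterm k V) :
    M.Models s h ↔ ∀ l ∈ M.literals, l.Holds (Test.Holds s h) := by
  have e : ∀ l : Literal (Atom k V),
      (l.map Test.atom).Holds (Test.Holds s h) ↔ l.Holds (Atom.Holds s h) := by
    rintro (a | a) <;> simp [Literal.map, Literal.Holds, Test.Holds]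
  obtain ⟨core, uLo, uHi, hMin, hMax⟩ := M
  simp only [Minterm.literals, List.mem_append, or_imp, forall_and, List.forall_mem_map, e,
    Minterm.Models, CoreHolds, Finset.mem_toList, and_assoc]
  cases uLo <;> cases uHi <;> cases hMax <;> simp [Literal.Holds, Test.Holds]

theorem sat_minterm (s : V → U) (h : Heap k U) (M : Minterm k V) :
    Sat s h M.toFormula ↔ M.Models s h := by
  rw [models_iff_literals, Minterm.toFormula, sat_conj, List.forall_mem_map]
  simp only [sat_literal]

theorem sat_disj_minterms (s : V → U) (h : Heap k U) (S : List (Minterm k V)) :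
    Sat s h (.disj (S.map Minterm.toFormula)) ↔ ∃ M ∈ S, M.Models s h := by
  simp [sat_disj, sat_minterm]

end Semantics

/-! ### Bounds as integers -/

/-- The universes of a given kind. -/
def Fits (d : UnivKind) (U : Type u) : Prop :=
  match d with
  | .fin => Finite U ∧ Nonempty U
  | .inf => Infinite U

/-- The bound `|U| - n` is used only over finite universes. -/
def Bound.Ok (d : UnivKind) : Bound → Prop
  | num _ => True
  | univSub _ => d = .fin

/-- The value of a bound over a universe with `u` elements. -/
def Bound.val (u : ℕ) : Bound → ℤ
  | num n => n
  | univSub n => u - n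

/-- The test formula `|h| ≥ |U| - n` is used only over finite universes. -/
def Test.Ok {k : ℕ} {V : Type v} (d : UnivKind) : Test k V → Prop
  | heapGeUniv _ => d = .fin
  | _ => True

/-- The bound `|U| - n` is used in a minterm only over finite universes. -/
def Minterm.Ok {k : ℕ} {V : Type v} (d : UnivKind) (M : Minterm k V) : Prop :=
  M.hMin.Ok d ∧ ∀ b ∈ M.hMax, b.Ok d

section Represents

variable {k : ℕ} {V : Type v} {U : Type u} {d : UnivKind} {s : V → U}

theorem Test.ok_fin (t : Test k V) : t.Ok .fin := by cases t <;> simp [Ok]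

theorem Bound.test_ok {b : Bound} (hb : b.Ok d) : (b.test : Test k V).Ok d := by
  cases b <;> simp_all [Bound.Ok, Bound.test, Test.Ok]

/-- Only the bound |U| - n reads `Nat.card U`, and `Ok` restricts it to finite universes, where that
number is the true size. Integer values avoid truncated subtraction. -/
theorem Bound.holds_test (hU : Fits d U) {b : Bound} (hb : b.Ok d) (h : Heap k U) :
    (b.test : Test k V).Holds s h ↔ b.val (Nat.card U) ≤ h.card := by
  cases b with
  | num n => simp [Bound.test, Test.Holds, Bound.val]
  | univSub n =>
    obtain rfl : d = .fin := hb
    have := hU.1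
    simp only [Bound.test, Test.Holds, Bound.val, this, true_and]
    omega

theorem Minterm.models_iff (hU : Fits d U) {M : Minterm k V} (hM : M.Ok d) (h : Heap k U) :
    M.Models s h ↔ CoreHolds s h M.core ∧ (∀ n ∈ M.uLo, UnivGe U n) ∧ (∀ n ∈ M.uHi, ¬ UnivGe U n) ∧
      M.hMin.val (Nat.card U) ≤ h.card ∧ ∀ b ∈ M.hMax, h.card < b.val (Nat.card U) := by
  rw [Minterm.Models, Bound.holds_test hU hM.1]
  refine and_congr_right fun _ => and_congr_right fun _ => and_congr_right fun _ =>
    and_congr_right fun _ => forall₂_congr fun b hb => ?_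
  rw [Bound.holds_test hU (hM.2 b hb), not_le]

/-- The list `S` of minterms is equivalent to the property `p` of heaps. -/
def Represents (d : UnivKind) (s : V → U) (S : List (Minterm k V)) (p : Heap k U → Prop) : Prop :=
  (∀ M ∈ S, M.Ok d) ∧ ∀ h, (∃ M ∈ S, M.Models s h) ↔ p h

theorem Represents.congr {S : List (Minterm k V)} {p q : Heap k U → Prop}
    (H : Represents d s S p) (e : ∀ h, p h ↔ q h) : Represents d s S q :=
  ⟨H.1, fun h => (H.2 h).trans (e h)⟩

theorem represents_nil : Represents d s ([] : List (Minterm k V)) fun _ => False := by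
  simp [Represents]

/-- The clauses of `mu` are nested unions; each layer becomes one existential quantifier over its
index. -/
theorem represents_flatMap {α : Type*} {l : List α} {f : α → List (Minterm k V)}
    {p : α → Heap k U → Prop} (H : ∀ a ∈ l, Represents d s (f a) (p a)) :
    Represents d s (l.flatMap f) fun h => ∃ a ∈ l, p a h := by
  refine ⟨fun M hM => ?_, fun h => ?_⟩
  · obtain ⟨a, ha, hM⟩ := List.mem_flatMap.1 hM
    exact (H a ha).1 M hM
  · constructor
    · rintro ⟨M, hM, hh⟩
      obtain ⟨a, ha, hM⟩ := List.mem_flatMap.1 hM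
      exact ⟨a, ha, ((H a ha).2 h).1 ⟨M, hM, hh⟩⟩
    · rintro ⟨a, ha, hp⟩
      obtain ⟨M, hM, hh⟩ := ((H a ha).2 h).2 hp
      exact ⟨M, List.mem_flatMap.2 ⟨a, ha, hM⟩, hh⟩

/-! ### Conjunctions of minterms -/

theorem univGe_max {m n : ℕ} : UnivGe U (max m n) ↔ UnivGe U m ∧ UnivGe U n := by
  constructor
  · exact fun h => ⟨h.mono (le_max_left _ _), h.mono (le_max_right _ _)⟩
  · rintro ⟨h₁, h₂⟩
    rcases max_choice m n with e | e <;> rwa [e]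

theorem univGe_min {m n : ℕ} : UnivGe U (min m n) ↔ UnivGe U m ∨ UnivGe U n := by
  constructor
  · intro h
    rcases min_choice m n with e | e <;> rw [e] at h
    exacts [Or.inl h, Or.inr h]
  · rintro (h | h)
    exacts [h.mono (min_le_left _ _), h.mono (min_le_right _ _)]

theorem forall_mem_merge_max (a b : Option ℕ) :
    (∀ n ∈ a.merge max b, UnivGe U n) ↔ (∀ n ∈ a, UnivGe U n) ∧ ∀ n ∈ b, UnivGe U n := by
  cases a <;> cases b <;> simp [Option.merge, univGe_max]

theorem forall_mem_merge_min (a b : Option ℕ) :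
    (∀ n ∈ a.merge min b, ¬ UnivGe U n) ↔ (∀ n ∈ a, ¬ UnivGe U n) ∧ ∀ n ∈ b, ¬ UnivGe U n := by
  cases a <;> cases b <;> simp [Option.merge, univGe_min]

/-- In the mixed case the larger of a and |U| - m is wanted, and |U| < a + m + 1 says precisely that
|U| - m ≤ a. The size of the universe therefore selects the stronger bound. -/
theorem minConj_iff (hU : Fits d U) {a b : Bound} (ha : a.Ok d) (hb : b.Ok d) (h : Heap k U) :
    (∃ p ∈ minConj a b, p.1.val (Nat.card U) ≤ h.card ∧ (∀ n ∈ p.2.1, UnivGe U n) ∧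
      ∀ n ∈ p.2.2, ¬ UnivGe U n) ↔ a.val (Nat.card U) ≤ h.card ∧ b.val (Nat.card U) ≤ h.card := by
  cases a <;> cases b
  case num.num => simp [minConj, Bound.val]
  all_goals
    obtain rfl : d = .fin := by assumption
    have := hU.1
    simp [minConj, Bound.val, univGe_iff]
    omega

/-- Dually, the smaller of a and |U| - m is wanted, and |U| ≥ a + m says precisely that a ≤ |U| - m.
-/
theorem maxConj_iff (hU : Fits d U) {a b : Option Bound} (ha : ∀ x ∈ a, x.Ok d)
    (hb : ∀ x ∈ b, x.Ok d) (h : Heap k U) :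
    (∃ q ∈ maxConj a b, (∀ x ∈ q.1, h.card < x.val (Nat.card U)) ∧ (∀ n ∈ q.2.1, UnivGe U n) ∧
      ∀ n ∈ q.2.2, ¬ UnivGe U n) ↔
      (∀ x ∈ a, h.card < x.val (Nat.card U)) ∧ ∀ x ∈ b, h.card < x.val (Nat.card U) := by
  rcases a with _ | a
  · simp [maxConj]
  rcases b with _ | b
  · simp [maxConj]
  replace ha := ha a rfl
  replace hb := hb b rfl
  cases a <;> cases b
  case num.num => simp [maxConj, Bound.val]
  all_goals
    obtain rfl : d = .fin := by assumption
    have := hU.1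
    simp [maxConj, Bound.val, univGe_iff]
    omega

theorem minConj_ok {a b : Bound} (ha : a.Ok d) (hb : b.Ok d) : ∀ p ∈ minConj a b, p.1.Ok d := by
  cases a <;> cases b <;> simp_all [minConj, Bound.Ok]

theorem maxConj_ok {a b : Option Bound} (ha : ∀ x ∈ a, x.Ok d) (hb : ∀ x ∈ b, x.Ok d) :
    ∀ q ∈ maxConj a b, ∀ x ∈ q.1, x.Ok d := by
  rcases a with _ | a
  · simpa [maxConj] using hb
  rcases b with _ | b
  · simpa [maxConj] using ha
  replace ha := ha a rfl
  replace hb := hb b rfl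
  cases a <;> cases b <;> simp_all [maxConj, Bound.Ok]

theorem coreHolds_union [DecidableEq V] (h : Heap k U) (T₁ T₂ : Finset (Literal (Atom k V))) :
    CoreHolds s h (T₁ ∪ T₂) ↔ CoreHolds s h T₁ ∧ CoreHolds s h T₂ := by
  simp [CoreHolds, or_imp, forall_and]

theorem represents_mintermConj [DecidableEq V] (hU : Fits d U) {M N : Minterm k V} (hM : M.Ok d)
    (hN : N.Ok d) :
    Represents d s (mintermConj M N) fun h => M.Models s h ∧ N.Models s h := by
  have hok : ∀ P ∈ mintermConj M N, P.Ok d := by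
    intro P hP
    simp only [mintermConj, List.mem_flatMap, List.mem_map] at hP
    obtain ⟨p, hp, q, hq, rfl⟩ := hP
    exact ⟨minConj_ok hM.1 hN.1 p hp, maxConj_ok hM.2 hN.2 q hq⟩
  refine ⟨hok, fun h => ?_⟩
  -- With the bounds as integers, the choices `p` for the minima and `q` for the maxima are
  -- independent and can be treated separately.
  have e : (∃ P ∈ mintermConj M N, P.Models s h) ↔
      ∃ P ∈ mintermConj M N, CoreHolds s h P.core ∧ (∀ n ∈ P.uLo, UnivGe U n) ∧
        (∀ n ∈ P.uHi, ¬ UnivGe U n) ∧ P.hMin.val (Nat.card U) ≤ h.card ∧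
        ∀ b ∈ P.hMax, h.card < b.val (Nat.card U) :=
    exists_congr fun P => and_congr_right fun hP => Minterm.models_iff hU (hok P hP) h
  refine e.trans ?_
  simp only [Minterm.models_iff hU hM, Minterm.models_iff hU hN]
  have h₁ := minConj_iff hU hM.1 hN.1 h
  have h₂ := maxConj_iff hU hM.2 hN.2 h
  constructor
  · rintro ⟨P, hP, H⟩
    simp only [mintermConj, List.mem_flatMap, List.mem_map] at hP
    obtain ⟨p, hp, q, hq, rfl⟩ := hP
    simp only [forall_mem_merge_max, forall_mem_merge_min, coreHolds_union] at H
    have h₁ := h₁.1 ⟨p, hp, by tauto⟩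
    have h₂ := h₂.1 ⟨q, hq, by tauto⟩
    tauto
  · intro H
    obtain ⟨p, hp, H₁⟩ := h₁.2 (by tauto)
    obtain ⟨q, hq, H₂⟩ := h₂.2 (by tauto)
    refine ⟨_, by
      simp only [mintermConj, List.mem_flatMap, List.mem_map]; exact ⟨p, hp, q, hq, rfl⟩, ?_⟩
    simp only [forall_mem_merge_max, forall_mem_merge_min, coreHolds_union]
    tauto

theorem represents_andMinterms [DecidableEq V] (hU : Fits d U) {S T : List (Minterm k V)}
    {p q : Heap k U → Prop}
    (hS : Represents d s S p) (hT : Represents d s T q) :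
    Represents d s (andMinterms S T) fun h => p h ∧ q h := by
  refine (represents_flatMap fun M hM => represents_flatMap fun N hN =>
    represents_mintermConj hU (hS.1 M hM) (hT.1 N hN)).congr fun h => ?_
  rw [← hS.2, ← hT.2]
  constructor
  · rintro ⟨M, hM, N, hN, h₁, h₂⟩; exact ⟨⟨M, hM, h₁⟩, N, hN, h₂⟩
  · rintro ⟨⟨M, hM, h₁⟩, N, hN, h₂⟩; exact ⟨M, hM, N, hN, h₁, h₂⟩

theorem represents_trivial : Represents d s [(Minterm.trivial : Minterm k V)] fun _ => True := by
  simp [Represents, Minterm.trivial, Minterm.Ok, Bound.Ok, Minterm.Models, CoreHolds, Bound.test,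
    Test.Holds]

theorem represents_mintermOf {l : Literal (Test k V)} (hl : l.atom.Ok d) :
    Represents d s (mintermOf l) fun h => l.Holds (Test.Holds s h) := by
  rcases l with (_ | _ | _ | _ | _) | (_ | _ | _ | _ | _) <;>
    simp_all [Represents, mintermOf, Minterm.trivial, Minterm.Ok, Bound.Ok, Minterm.Models,
      CoreHolds, Bound.test, Test.Holds, Literal.Holds, Literal.atom, Test.Ok]

theorem represents_foldl [DecidableEq V] (hU : Fits d U) {ls : List (Literal (Test k V))}
    (hls : ∀ l ∈ ls, l.atom.Ok d) {S : List (Minterm k V)} {p : Heap k U → Prop}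
    (hS : Represents d s S p) :
    Represents d s (ls.foldl (fun S l => andMinterms S (mintermOf l)) S)
      fun h => p h ∧ ∀ l ∈ ls, l.Holds (Test.Holds s h) := by
  induction ls generalizing S p with
  | nil => simpa using hS
  | cons l ls ih =>
    refine (ih (fun l' hl' => hls l' (List.mem_cons_of_mem _ hl')) (represents_andMinterms hU hS
      (represents_mintermOf (hls l List.mem_cons_self)))).congr fun h => ?_
    simp [and_assoc]

theorem represents_clause [DecidableEq V] (hU : Fits d U) {ls : List (Literal (Test k V))}
    (hls : ∀ l ∈ ls, l.atom.Ok d) :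
    Represents d s (mintermsOfClause ls) fun h => ∀ l ∈ ls, l.Holds (Test.Holds s h) := by
  cases ls with
  | nil => simpa [mintermsOfClause] using represents_trivial
  | cons l ls =>
    refine (represents_foldl hU (fun l' hl' => hls l' (List.mem_cons_of_mem _ hl'))
      (represents_mintermOf (hls l List.mem_cons_self))).congr fun h => ?_
    simp

theorem Minterm.Ok.literals {M : Minterm k V} (hM : M.Ok d) : ∀ l ∈ M.literals, l.atom.Ok d := by
  obtain ⟨core, uLo, uHi, hMin, hMax⟩ := M
  obtain ⟨h₁, h₂⟩ := hM
  have e : ∀ l : Literal (Atom k V), (l.map Test.atom).atom.Ok d := by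
    rintro (a | a) <;> simp [Literal.map, Literal.atom, Test.Ok]
  simp only [Minterm.literals, List.mem_append, or_imp, forall_and, List.forall_mem_map]
  refine ⟨⟨⟨fun l _ => e l, ?_⟩, ?_⟩, ?_⟩
  · simp [Literal.atom, Test.Ok]
  · simp [Literal.atom, Test.Ok]
  · have := Bound.test_ok (k := k) (V := V) h₁
    rcases hMax with _ | b
    · simpa [Literal.atom, Test.Ok] using this
    · have := Bound.test_ok (k := k) (V := V) (h₂ b rfl)
      simp_all [Literal.atom]

/-- By De Morgan and distributivity: all minterms fail exactly when one false literal can be picked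
from each, and such a choice is a section of the list of literal lists. -/
theorem represents_negMinterms [DecidableEq V] (hU : Fits d U) {S : List (Minterm k V)}
    {p : Heap k U → Prop}
    (hS : Represents d s S p) : Represents d s (negMinterms S) fun h => ¬ p h := by
  have key : ∀ (S : List (Minterm k V)) (h : Heap k U),
      (∃ ls ∈ (S.map Minterm.literals).sections, ∀ l ∈ ls.map Literal.compl,
        l.Holds (Test.Holds s h)) ↔ ∀ M ∈ S, ¬ M.Models s h := by
    intro S h
    simp only [List.mem_sections, List.forall_mem_map, Literal.holds_compl, models_iff_literals]
    induction S with
    | nil => simp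
    | cons M S ih =>
      simp only [List.map_cons, List.forall_mem_cons, ← ih]
      constructor
      · rintro ⟨ls, hls, H⟩
        cases hls with
        | cons h₁ h₂ =>
          simp only [List.forall_mem_cons] at H
          exact ⟨fun h' => H.1 (h' _ h₁), _, h₂, H.2⟩
      · rintro ⟨h₁, ls, h₂, H⟩
        push Not at h₁
        obtain ⟨l, hl, hl'⟩ := h₁
        exact ⟨l :: ls, .cons hl h₂, by simpa using ⟨hl', H⟩⟩
  refine (represents_flatMap (p := fun ls h => ∀ l ∈ ls.map Literal.compl, l.Holds (Test.Holds s h))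
    fun ls hls => represents_clause hU ?_).congr fun h => ?_
  · rw [List.mem_sections] at hls
    have hok := hS.1
    clear hS
    induction S generalizing ls with
    | nil => cases hls; simp
    | cons M S ih =>
      cases hls with
      | cons h₁ h₂ =>
        rename_i l ls
        simp only [List.map_cons, List.forall_mem_cons] at hok ⊢
        refine ⟨?_, ih ls h₂ hok.2⟩
        have := Minterm.Ok.literals hok.1 l h₁
        cases l <;> simpa [Literal.compl, Literal.atom] using this
  · rw [key, ← hS.2 h]; simp

end Represents

/-! ### Boolean combinations -/

namespace BoolComb

/-- The truth value of a boolean combination, given the truth values of the atoms. -/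
def Holds {α : Type v} (p : α → Prop) : BoolComb α → Prop
  | bot => False
  | top => True
  | atom a => p a
  | and f g => f.Holds p ∧ g.Holds p
  | neg f => ¬ f.Holds p

/-- All atoms satisfy `p`. -/
def All {α : Type v} (p : α → Prop) : BoolComb α → Prop
  | bot => True
  | top => True
  | atom a => p a
  | and f g => f.All p ∧ g.All p
  | neg f => f.All p

variable {α : Type v} {p : α → Prop}

theorem All.of_forall (H : ∀ a, p a) (f : BoolComb α) : f.All p := by
  induction f <;> simp_all [All]

@[simp] theorem holds_imp {f g : BoolComb α} : (f.imp g).Holds p ↔ (f.Holds p → g.Holds p) := by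
  simp [imp, Holds]

@[simp] theorem all_imp {f g : BoolComb α} : (f.imp g).All p ↔ f.All p ∧ g.All p := by
  simp [imp, All]

@[simp] theorem holds_conj {l : List (BoolComb α)} : (conj l).Holds p ↔ ∀ f ∈ l, f.Holds p := by
  induction l with
  | nil => simp [conj, Holds]
  | cons f l ih => simpa [conj, Holds] using fun _ => ih

@[simp] theorem all_conj {l : List (BoolComb α)} : (conj l).All p ↔ ∀ f ∈ l, f.All p := by
  induction l with
  | nil => simp [conj, All]
  | cons f l ih => simpa [conj, All] using fun _ => ih

@[simp] theorem holds_ofLiteral {l : Literal α} : (ofLiteral l).Holds p ↔ l.Holds p := by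
  cases l <;> simp [ofLiteral, Holds, Literal.Holds]

@[simp] theorem all_ofLiteral {l : Literal α} : (ofLiteral l).All p ↔ p l.atom := by
  cases l <;> simp [ofLiteral, All, Literal.atom]

/-- Negation exchanges the two polarities, so they are proved in one induction. -/
theorem dnfAux_holds (f : BoolComb α) :
    ((∃ c ∈ dnfAux true f, ∀ l ∈ c, l.Holds p) ↔ f.Holds p) ∧
      ((∃ c ∈ dnfAux false f, ∀ l ∈ c, l.Holds p) ↔ ¬ f.Holds p) := by
  induction f with
  | bot => simp [dnfAux, Holds]
  | top => simp [dnfAux, Holds]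
  | atom a => simp [dnfAux, Holds, Literal.Holds]
  | neg f ih => simpa [dnfAux, Holds, and_comm] using ih
  | and f g ihf ihg =>
    constructor
    · simp only [dnfAux, Holds, ← ihf.1, ← ihg.1, List.mem_flatMap, List.mem_map]
      constructor
      · rintro ⟨_, ⟨c, hc, e, he, rfl⟩, H⟩
        simp only [List.mem_append, or_imp, forall_and] at H
        exact ⟨⟨c, hc, H.1⟩, e, he, H.2⟩
      · rintro ⟨⟨c, hc, h₁⟩, e, he, h₂⟩
        refine ⟨_, ⟨c, hc, e, he, rfl⟩, ?_⟩
        simp only [List.mem_append, or_imp, forall_and]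
        exact ⟨h₁, h₂⟩
    · simp only [dnfAux, Holds, not_and_or, ← ihf.2, ← ihg.2, List.mem_append, or_and_right,
        exists_or]

theorem dnfAux_all (f : BoolComb α) (hf : f.All p) (b : Bool) :
    ∀ c ∈ dnfAux b f, ∀ l ∈ c, p l.atom := by
  induction f generalizing b with
  | bot => cases b <;> simp [dnfAux]
  | top => cases b <;> simp [dnfAux]
  | atom a => cases b <;> simpa [dnfAux, Literal.atom, All] using hf
  | neg f ih => simpa [dnfAux] using ih hf (!b)
  | and f g ihf ihg =>
    cases b
    · simp only [dnfAux, List.mem_append, or_imp, forall_and]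
      exact ⟨ihf hf.1 false, ihg hf.2 false⟩
    · simp only [dnfAux, List.mem_flatMap, List.mem_map]
      rintro _ ⟨c, hc, e, he, rfl⟩ l hl
      rcases List.mem_append.1 hl with hl | hl
      exacts [ihf hf.1 true c hc l hl, ihg hf.2 true e he l hl]

theorem represents_minterms {k : ℕ} {V : Type v} {U : Type u} [DecidableEq V] {d : UnivKind}
    {s : V → U} (hU : Fits d U) {f : BoolComb (Test k V)} (hf : f.All (Test.Ok d)) :
    Represents d s f.minterms fun h => f.Holds (Test.Holds s h) :=
  (represents_flatMap fun c hc => represents_clause hU (dnfAux_all f hf true c hc)).congr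
    fun _ => (dnfAux_holds f).1

end BoolComb

/-! ### Linear comparisons -/

section Linear

variable {k : ℕ} {V : Type v} {U : Type u} {d : UnivKind} {s : V → U}

/-- The inequality |h| ≤ |U| leaves finitely many sizes to list. For α > 1, α|U| + β ≤ |h| forces (α
- 1)|U| ≤ -β, so it fails for large |U|. For α < 0 the left side is negative for large |U|, so it
holds trivially. With α = 1 and β > 0 it is never satisfied. -/
theorem holds_heapGeLin (hU : Fits d U) {t : ℤ × ℤ} (ht : d = .fin ∨ t.1 = 0) (h : Heap k U) :
    (heapGeLin t : BoolComb (Test k V)).Holds (Test.Holds s h) ↔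
      t.1 * Nat.card U + t.2 ≤ h.card := by
  obtain ⟨α, β⟩ := t
  by_cases h0 : α = 0
  · simp [heapGeLin, h0, BoolComb.Holds, Test.Holds]
  obtain rfl : d = .fin := by simpa [h0] using ht
  obtain ⟨hfin, hne⟩ := hU
  have hpos : 0 < Nat.card U := Nat.card_pos
  have hle := h.card_le_natCard
  generalize hu : Nat.card U = u at *
  by_cases h1 : α = 1
  · by_cases hβ : β ≤ 0
    · simp only
        [heapGeLin, h1, hβ, one_ne_zero, one_mul, true_and, if_true, if_false, BoolComb.Holds,
        Test.Holds, hfin, hu]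
      omega
    · simp only [heapGeLin, h1, hβ, one_ne_zero, one_mul, if_true, if_false, BoolComb.Holds,
        false_iff, not_le]
      omega
  have key : ∀ N : ℕ, (BoolComb.conj ((List.range N).map fun i : ℕ =>
        (univEq (i + 1)).imp (.atom (.heapGe (α * (i + 1) + β).toNat))) :
          BoolComb (Test k V)).Holds (Test.Holds s h) ↔ (u ≤ N → α * u + β ≤ h.card) := by
    intro N
    simp only [BoolComb.holds_conj, List.forall_mem_map, List.mem_range, BoolComb.holds_imp,
      univEq, univLt, univGe, BoolComb.Holds, Test.Holds, univGe_iff, hu, Int.toNat_le]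
    constructor
    · intro H hN
      -- Index `i` stands for size `i + 1`. Size 0 is not listed and need not be, the universe being
      -- nonempty.
      have := H (u - 1) (by omega) (by omega)
      rwa [show ((u - 1 : ℕ) : ℤ) + 1 = u by omega] at this
    · intro H i hi hiu
      obtain rfl : u = i + 1 := by omega
      simpa using H (by omega)
  by_cases h2 : 1 < α
  · by_cases hβ : 0 < β
    · simp only [heapGeLin, h0, h1, h2, hβ, if_true, if_false, BoolComb.Holds, false_iff, not_le]
      nlinarith
    · simp only [heapGeLin, h0, h1, h2, hβ, if_true, if_false]
      rw [BoolComb.Holds, key]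
      simp only
          [univLt, univGe, BoolComb.Holds, Test.Holds, univGe_iff, hu, not_le, Nat.lt_succ_iff]
      constructor
      · exact fun H => H.2 H.1
      · intro H
        refine ⟨?_, fun _ => H⟩
        have : (u : ℤ) ≤ -β / (α - 1) := by
          rw [Int.le_ediv_iff_mul_le (by omega)]
          have : (h.card : ℤ) ≤ u := by exact_mod_cast hle
          linarith
        omega
  · by_cases hβ : β < 0
    · simp only [heapGeLin, h0, h1, h2, hβ, if_true, if_false, BoolComb.Holds, true_iff]
      have : α * u ≤ 0 := mul_nonpos_of_nonpos_of_nonneg (by omega) (by omega)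
      omega
    · simp only [heapGeLin, h0, h1, h2, hβ, if_false]
      rw [key]
      refine ⟨fun H => ?_, fun H _ => H⟩
      by_cases hN : u ≤ (β / -α).toNat
      · exact H hN
      · have : β / -α < u := by omega
        rw [Int.ediv_lt_iff_lt_mul (by omega)] at this
        have : α * u + β < 0 := by linarith
        omega

theorem heapGeLin_all {t : ℤ × ℤ} (ht : d = .fin ∨ t.1 = 0) :
    (heapGeLin t : BoolComb (Test k V)).All (Test.Ok d) := by
  rcases ht with rfl | ht
  · exact BoolComb.All.of_forall Test.ok_fin _
  · simp [heapGeLin, ht, BoolComb.All, Test.Ok]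

theorem Bound.lin_fst {b : Bound} (hb : b.Ok d) : d = .fin ∨ b.lin.1 = 0 := by
  cases b
  · exact Or.inr rfl
  · exact Or.inl hb

theorem Bound.val_eq (u : ℕ) (b : Bound) : b.val u = b.lin.1 * u + b.lin.2 := by
  cases b <;> simp [Bound.val, Bound.lin]; rfl

theorem holds_truth {p : Test k V → Prop} {q : Prop}
    [Decidable q] : (truth q : BoolComb (Test k V)).Holds p ↔ q := by
  by_cases hq : q <;> simp [truth, hq, BoolComb.Holds]

theorem truth_all {p : Test k V → Prop} {q : Prop} [Decidable q] :
    (truth q : BoolComb (Test k V)).All p := by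
  by_cases hq : q <;> simp [truth, hq, BoolComb.All]

theorem holds_numLt (hU : Fits d U) (c : ℕ) {b : Option Bound} (hb : ∀ x ∈ b, x.Ok d)
    (h : Heap k U) : (numLt c b : BoolComb (Test k V)).Holds (Test.Holds s h) ↔
      ∀ x ∈ b, c < x.val (Nat.card U) := by
  rcases b with _ | _ | n
  · simp [numLt, BoolComb.Holds]
  · exact holds_truth.trans (by simp [Bound.val])
  · obtain rfl : d = .fin := hb _ rfl
    have := hU.1
    simp [numLt, univGe, BoolComb.Holds, Test.Holds, univGe_iff, Bound.val]
    omega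

theorem numLt_all (c : ℕ) (b : Option Bound) :
    (numLt c b : BoolComb (Test k V)).All (Test.Ok d) := by
  rcases b with _ | _ | n
  · trivial
  · exact truth_all
  · trivial

end Linear

/-- One set of representatives of the common fibres is mapped injectively onto both images. No
finiteness is required. -/
theorem ncard_image_eq_of_ker {α β γ : Type*} {f : α → β} {g : α → γ} {A : Set α}
    (H : ∀ a ∈ A, ∀ b ∈ A, f a = f b ↔ g a = g b) : (f '' A).ncard = (g '' A).ncard := by
  obtain ⟨B, hBA, hB⟩ := Set.exists_subset_bijOn A f
  have hg : Set.InjOn g B := fun a ha b hb e => hB.injOn ha hb ((H a (hBA ha) b (hBA hb)).2 e)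
  have hgB : g '' B = g '' A := by
    refine (Set.image_mono hBA).antisymm ?_
    rintro _ ⟨a, ha, rfl⟩
    obtain ⟨b, hb, e⟩ := hB.surjOn ⟨a, ha, rfl⟩
    exact ⟨b, hb, (H b (hBA hb) a ha).1 e⟩
  rw [← hB.image_eq, hB.injOn.ncard_image, ← hgB, hg.ncard_image]

/-! ### Sets of literals: variables as locations, consistency -/

section LiteralSets

variable {k : ℕ} {V : Type v} {U : Type u} {s : V → U} {h : Heap k U}
  {T T' : Finset (Literal (Atom k V))}

theorem Eqv.refl (T : Finset (Literal (Atom k V))) (x : V) : Eqv T x x := (eqvSetoid T).refl x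

theorem Eqv.symm {x y : V} (e : Eqv T x y) : Eqv T y x := (eqvSetoid T).symm e

theorem Eqv.trans {x y z : V} (e : Eqv T x y) (e' : Eqv T y z) : Eqv T x z :=
  (eqvSetoid T).trans e e'

theorem Eqv.of_mem {x y : V} (e : .pos (.eq x y) ∈ T) : Eqv T x y := Relation.EqvGen.rel _ _ e

theorem mk_eq_mk_iff {x y : V} :
    Quotient.mk (eqvSetoid T) x = Quotient.mk (eqvSetoid T) y ↔ Eqv T x y := Quotient.eq

theorem mem_eqPart {l : Literal (Atom k V)} : l ∈ eqPart T ↔ l ∈ T ∧ l.atom.isEq = true := by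
  simp [eqPart]

theorem Eqv.store_eq (hT : CoreHolds s h (eqPart T)) {x y : V} (e : Eqv T x y) : s x = s y := by
  induction e with
  | rel x y e => exact hT _ (mem_eqPart.2 ⟨e, rfl⟩)
  | refl => rfl
  | symm _ _ _ ih => exact ih.symm
  | trans _ _ _ _ _ ih₁ ih₂ => exact ih₁.trans ih₂

theorem coreHolds_mono (H : CoreHolds s h T) (hT : T' ⊆ T) : CoreHolds s h T' :=
  fun l hl => H l (hT hl)

theorem eqPart_subset : eqPart T ⊆ T := Finset.filter_subset _ _

/-- On `X`, the relation `≈_T` is equality of the values in the store. -/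
def Separates (s : V → U) (T : Finset (Literal (Atom k V))) (X : Finset V) : Prop :=
  (∀ x y, Eqv T x y → s x = s y) ∧ ∀ x ∈ X, ∀ y ∈ X, s x = s y → Eqv T x y

/-- Every pair is decided, and a pair with equal values cannot be decided negatively. -/
theorem EComplete.separates {X : Finset V} (hX : EComplete T X) (hT : CoreHolds s h (eqPart T)) :
    Separates s T X := by
  refine ⟨fun x y => Eqv.store_eq hT, fun x hx y hy e => ?_⟩
  rcases hX x hx y hy with ⟨h₁, -⟩ | ⟨h₁, -⟩
  · exact Eqv.of_mem h₁
  · exact absurd e (hT _ (mem_eqPart.2 ⟨h₁, rfl⟩))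

theorem Separates.eqv_iff {X : Finset V} (H : Separates s T X) {x y : V} (hx : x ∈ X) (hy : y ∈ X) :
    Eqv T x y ↔ s x = s y := ⟨H.1 x y, H.2 x hx y hy⟩

theorem EComplete.notEqv {X : Finset V} (hX : EComplete T X) {x y : V} (hx : x ∈ X) (hy : y ∈ X)
    (hxy : ¬ Eqv T x y) : NotEqv T x y := by
  rcases hX x hx y hy with ⟨h₁, -⟩ | ⟨h₁, -⟩
  · exact absurd (Eqv.of_mem h₁) hxy
  · exact ⟨x, y, .refl _ _, .refl _ _, Or.inl h₁⟩

/-- This turns the numbers written into the elimination formulae into cardinalities of sets of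
locations. -/
theorem Separates.classCount_eq {X Y : Finset V} (H : Separates s T X) (hY : Y ⊆ X) :
    classCount T Y = (s '' Y).ncard :=
  ncard_image_eq_of_ker fun _ hx _ hy => mk_eq_mk_iff.trans (H.eqv_iff (hY hx) (hY hy))

theorem mem_fv [DecidableEq V] {l : Literal (Atom k V)} {x : V} (hl : l ∈ T) (hx : x ∈ l.atom.vars) :
    x ∈ fv T :=
  Finset.mem_biUnion.2 ⟨l, hl, hx⟩

theorem fv_mono [DecidableEq V] (hT : T ⊆ T') : fv T ⊆ fv T' :=
    Finset.biUnion_subset_biUnion_of_subset_left _ hT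

theorem mem_avar [DecidableEq V] {x : V} : x ∈ avar T ↔ x ∈ fv T ∧
    ∃ x', Eqv T x x' ∧ (.pos (.alloc x') ∈ T ∨ ∃ y, .pos (.pto x' y) ∈ T) := by
  simp [avar]

theorem mem_nvar [DecidableEq V] {x : V} : x ∈ nvar T ↔ x ∈ fv T ∧
    ∃ x', Eqv T x x' ∧ .neg (.alloc x') ∈ T := by
  simp [nvar]

theorem avar_subset [DecidableEq V] : avar T ⊆ fv T := fun _ hx => (mem_avar.1 hx).1

theorem nvar_subset [DecidableEq V] : nvar T ⊆ fv T := fun _ hx => (mem_nvar.1 hx).1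

theorem mem_avar_of_alloc [DecidableEq V] {x : V} (hx : .pos (.alloc x) ∈ T) : x ∈ avar T :=
  mem_avar.2 ⟨mem_fv hx (by simp [Literal.atom, Atom.vars]), x, .refl _ _, Or.inl hx⟩

theorem mem_avar_of_pto [DecidableEq V] {x : V} {y : Fin k → V} (hx : .pos (.pto x y) ∈ T) :
    x ∈ avar T :=
  mem_avar.2
    ⟨mem_fv hx (by simp [Literal.atom, Atom.vars]), x, .refl _ _, Or.inr ⟨y, hx⟩⟩

theorem mem_nvar_of_alloc [DecidableEq V] {x : V} (hx : .neg (.alloc x) ∈ T) : x ∈ nvar T :=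
  mem_nvar.2 ⟨mem_fv hx (by simp [Literal.atom, Atom.vars]), x, .refl _ _, hx⟩

theorem mem_fv_of_pto [DecidableEq V] {x : V} {y : Fin k → V} (hx : .pos (.pto x y) ∈ T) :
    x ∈ fv T ∧ ∀ i, y i ∈ fv T :=
  ⟨mem_fv hx (by simp [Literal.atom, Atom.vars]),
    fun i => mem_fv hx (by simp [Literal.atom, Atom.vars])⟩

theorem mem_fv_of_neg_pto [DecidableEq V] {x : V} {y : Fin k → V} (hx : .neg (.pto x y) ∈ T) :
    x ∈ fv T ∧ ∀ i, y i ∈ fv T :=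
  ⟨mem_fv hx (by simp [Literal.atom, Atom.vars]),
    fun i => mem_fv hx (by simp [Literal.atom, Atom.vars])⟩

theorem mem_avar_of_eqv [DecidableEq V] {x y : V} (hx : x ∈ avar T) (e : Eqv T x y) (hy : y ∈ fv T) :
    y ∈ avar T := by
  obtain ⟨-, x', e', hx'⟩ := mem_avar.1 hx
  exact mem_avar.2 ⟨hy, x', e.symm.trans e', hx'⟩

theorem mem_nvar_of_eqv [DecidableEq V] {x y : V} (hx : x ∈ nvar T) (e : Eqv T x y) (hy : y ∈ fv T) :
    y ∈ nvar T := by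
  obtain ⟨-, x', e', hx'⟩ := mem_nvar.1 hx
  exact mem_nvar.2 ⟨hy, x', e.symm.trans e', hx'⟩

theorem FootprintConsistent.notMem_nvar [DecidableEq V] (hT : FootprintConsistent T) {x : V}
    (hx : x ∈ avar T) :
    x ∉ nvar T := by
  intro hn
  obtain ⟨-, x', e', hx'⟩ := mem_avar.1 hx
  obtain ⟨-, x'', e'', hx''⟩ := mem_nvar.1 hn
  rcases hx' with hx' | ⟨y, hx'⟩
  · exact (hT x' x'' (fun _ => x) (fun _ => x) (e'.symm.trans e'') fun _ => .refl _ _).1 hx' hx''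
  · exact ((hT x' x'' y y (e'.symm.trans e'') fun _ => .refl _ _).2 hx').1 hx''

theorem CoreHolds.mem_dom [DecidableEq V] (H : CoreHolds s h T) {x : V} (hx : x ∈ avar T) :
    s x ∈ h.dom := by
  obtain ⟨-, x', e, hx'⟩ := mem_avar.1 hx
  rw [Eqv.store_eq (coreHolds_mono H eqPart_subset) e]
  rcases hx' with hx' | ⟨y, hx'⟩
  · exact H _ hx'
  · exact Heap.mem_dom_of_map_eq_some (H _ hx')

theorem CoreHolds.notMem_dom [DecidableEq V] (H : CoreHolds s h T) {x : V} (hx : x ∈ nvar T) :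
    s x ∉ h.dom := by
  obtain ⟨-, x', e, hx'⟩ := mem_nvar.1 hx
  rw [Eqv.store_eq (coreHolds_mono H eqPart_subset) e]
  exact H _ hx'

theorem CoreHolds.footprintConsistent (H : CoreHolds s h T) : FootprintConsistent T := by
  intro x x' y y' e ey
  have hs : ∀ {x y}, Eqv T x y → s x = s y := Eqv.store_eq (coreHolds_mono H eqPart_subset)
  refine ⟨fun h₁ h₂ => ?_, fun h₁ => ⟨fun h₂ => ?_, fun h₂ => ?_⟩⟩
  · have h₁ := H _ h₁; have h₂ := H _ h₂
    simp only [Literal.Holds, Atom.Holds] at h₁ h₂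
    exact h₂ (hs e ▸ h₁)
  · have h₁ := H _ h₁; have h₂ := H _ h₂
    simp only [Literal.Holds, Atom.Holds] at h₁ h₂
    exact h₂ (hs e ▸ Heap.mem_dom_of_map_eq_some h₁)
  · have h₁ := H _ h₁; have h₂ := H _ h₂
    simp only [Literal.Holds, Atom.Holds] at h₁ h₂
    refine h₂ ?_
    rw [← hs e, h₁]
    exact congrArg some (funext fun i => hs (ey i))

theorem CoreHolds.not_ptoConflict (H : CoreHolds s h T) : ¬ PtoConflict T := by
  rintro ⟨x, x', y, y', h₁, h₂, e, i, z, z', e₁, e₂, hz⟩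
  have hs : ∀ {x y}, Eqv T x y → s x = s y := Eqv.store_eq (coreHolds_mono H eqPart_subset)
  have h₁ := H _ h₁
  have h₂ := H _ h₂
  simp only [Literal.Holds, Atom.Holds] at h₁ h₂
  rw [hs e, h₂] at h₁
  have hi : s (y' i) = s (y i) := congrFun (Option.some.inj h₁) i
  rw [hs e₁, hs e₂] at hi
  rcases hz with hz | hz
  · exact H _ hz hi.symm
  · exact H _ hz hi

/-! ### Values of the elementary boolean combinations -/

theorem holds_conjLits : (conjLits T).Holds (Test.Holds s h) ↔ CoreHolds s h T := by
  simp only [conjLits, BoolComb.holds_conj, List.forall_mem_map, Finset.mem_toList,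
    BoolComb.holds_ofLiteral, CoreHolds]
  refine forall₂_congr fun l _ => ?_
  cases l <;> rfl

theorem conjLits_all {d : UnivKind} : (conjLits T).All (Test.Ok d) := by
  simp only [conjLits, BoolComb.all_conj, List.forall_mem_map, BoolComb.all_ofLiteral]
  rintro (l | l) _ <;> trivial

theorem holds_allocAll {X : Finset V} :
    (allocAll X).Holds (Test.Holds s h) ↔ ∀ x ∈ X, s x ∈ h.dom := by
  simp [allocAll, BoolComb.Holds, Test.Holds, Atom.Holds]

theorem allocAll_all {d : UnivKind} {X : Finset V} :
    (allocAll X : BoolComb (Test k V)).All (Test.Ok d) := by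
  simp [allocAll, BoolComb.All, Test.Ok]

theorem holds_nallocAll {X : Finset V} :
    (nallocAll X).Holds (Test.Holds s h) ↔ ∀ x ∈ X, s x ∉ h.dom := by
  simp [nallocAll, BoolComb.Holds, Test.Holds, Atom.Holds]

theorem nallocAll_all {d : UnivKind} {X : Finset V} :
    (nallocAll X : BoolComb (Test k V)).All (Test.Ok d) := by
  simp [nallocAll, BoolComb.All, Test.Ok]

/-! ### Domain closure -/

/-- Some tuple differs from all tuples that `T` excludes as the value of `x`. -/
def HasFreshTuple (s : V → U) (T : Finset (Literal (Atom k V))) (x : V) : Prop :=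
  ∃ t : Fin k → U, ∀ x' y, Eqv T x x' → .neg (.pto x' y) ∈ T → t ≠ fun i => s (y i)

theorem finite_setOf_neg_pto (x : V) :
    {y : Fin k → V | ∃ x', Eqv T x x' ∧ .neg (.pto x' y) ∈ T}.Finite := by
  have hinj : Function.Injective fun p : V × (Fin k → V) =>
      (Literal.neg (Atom.pto p.1 p.2) : Literal (Atom k V)) := by
    rintro ⟨a, b⟩ ⟨a', b'⟩ e
    simpa using e
  refine ((T.finite_toSet.preimage hinj.injOn).image Prod.snd).subset ?_
  rintro y ⟨x', -, hy⟩
  exact ⟨(x', y), hy, rfl⟩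

theorem Separates.dataNo_eq [DecidableEq V] {X : Finset V} (H : Separates s T X) (hX : fv T ⊆ X)
    (x : V) :
    dataNo x T = ((fun (y : Fin k → V) i => s (y i)) ''
      {y | ∃ x', Eqv T x x' ∧ .neg (.pto x' y) ∈ T}).ncard := by
  refine ncard_image_eq_of_ker ?_
  rintro y ⟨x₁, -, hy⟩ y' ⟨x₂, -, hy'⟩
  simp only [funext_iff, mk_eq_mk_iff]
  exact forall_congr' fun i => H.eqv_iff (hX ((mem_fv_of_neg_pto hy).2 i))
    (hX ((mem_fv_of_neg_pto hy').2 i))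

/-- Literals over equalities read only the store. -/
theorem coreHolds_eqPart_congr {h' : Heap k U} (H : CoreHolds s h (eqPart T)) :
    CoreHolds s h' (eqPart T) := by
  intro l hl
  have := H l hl
  have hl := (mem_eqPart.1 hl).2
  rcases l with (_ | _ | _) | (_ | _ | _) <;>
    first | exact this | simp [Literal.atom, Atom.isEq] at hl

/-- The tuple stored at `x` is itself different from every excluded one. -/
theorem CoreHolds.hasFreshTuple [DecidableEq V] (H : CoreHolds s h T) {x : V} (hx : x ∈ avar T) :
    HasFreshTuple s T x := by
  obtain ⟨t, ht⟩ := Option.ne_none_iff_exists'.1 (H.mem_dom hx)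
  refine ⟨t, fun x' y e hl et => H _ hl ?_⟩
  simp only [Atom.Holds]
  rw [← Eqv.store_eq (coreHolds_mono H eqPart_subset) e, ht, et]

theorem univGe_root_iff [Finite U] (hk : 0 < k) (n : ℕ) :
    UnivGe U (sInf {m : ℕ | n ≤ m ^ k}) ↔ n ≤ Nat.card U ^ k := by
  rw [univGe_iff]
  constructor
  · intro H
    -- Positivity of `k` puts `n` into the set; on an empty set the infimum would be the default
    -- value 0.
    have hm : sInf {m : ℕ | n ≤ m ^ k} ∈ {m : ℕ | n ≤ m ^ k} :=
      Nat.sInf_mem ⟨n, Nat.le_self_pow hk.ne' n⟩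
    exact le_trans hm (Nat.pow_le_pow_left H k)
  · exact fun H => Nat.sInf_le H

/-- Pigeonhole: the excluded tuples have `dataNo x T` distinct values among the |U|^k available. -/
theorem hasFreshTuple_iff [DecidableEq V] [Finite U] {X : Finset V} (H : Separates s T X)
    (hX : fv T ⊆ X) (x : V) :
    HasFreshTuple s T x ↔ dataNo x T + 1 ≤ Nat.card U ^ k := by
  have hc : Nat.card (Fin k → U) = Nat.card U ^ k := by simp [Nat.card_fun]
  rw [H.dataNo_eq hX, ← hc, Nat.succ_le_iff, ← Set.ncard_univ]
  set A := (fun (y : Fin k → V) i => s (y i)) '' {y | ∃ x', Eqv T x x' ∧ .neg (.pto x' y) ∈ T}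
    with hA
  have hf : HasFreshTuple s T x ↔ ∃ t, t ∉ A := by
    refine exists_congr fun t => ⟨?_, ?_⟩
    · rintro ht ⟨y, ⟨x', e, hy⟩, rfl⟩; exact ht x' y e hy rfl
    · rintro ht x' y e hy rfl; exact ht ⟨y, ⟨x', e, hy⟩, rfl⟩
  rw [hf]
  constructor
  · rintro ⟨t, ht⟩
    exact Set.ncard_lt_ncard (Set.ssubset_univ_iff.2 fun e => ht (e ▸ Set.mem_univ t))
  · intro hlt
    by_contra! hall
    rw [Set.eq_univ_of_forall hall] at hlt
    exact lt_irrefl _ hlt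

theorem hasFreshTuple_of_infinite [Infinite U] (hk : 0 < k) (x : V) : HasFreshTuple s T x := by
  have : Nonempty (Fin k) := ⟨⟨0, hk⟩⟩
  obtain ⟨t, ht⟩ := ((finite_setOf_neg_pto (T := T) x).image
    fun (y : Fin k → V) i => s (y i)).exists_notMem
  exact ⟨t, fun x' y e hy et => ht ⟨y, ⟨x', e, hy⟩, et.symm⟩⟩

theorem holds_domClosureU [DecidableEq V] {d : UnivKind} (hU : Fits d U) (hk : 0 < k)
    {M : Minterm k V}
    (hM : M.Ok d) {X : Finset V} (H : Separates s M.core X) (hX : fv M.core ⊆ X) :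
    (domClosureU M).Holds (Test.Holds s h) ↔ (∀ n ∈ M.uLo, UnivGe U n) ∧
      (∀ n ∈ M.uHi, ¬ UnivGe U n) ∧ (∀ x ∈ avar M.core, HasFreshTuple s M.core x) ∧
      ∀ b ∈ M.hMax, M.hMin.val (Nat.card U) < b.val (Nat.card U) := by
  -- The supremum collects the conditions for all allocated variables into one; over an infinite
  -- universe both sides are simply true.
  have h₁ : UnivGe U (sInf {m : ℕ | ((avar M.core).sup fun x => dataNo x M.core + 1) ≤ m ^ k}) ↔
      ∀ x ∈ avar M.core, HasFreshTuple s M.core x := by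
    cases d with
    | fin =>
      have := hU.1
      rw [univGe_root_iff hk, Finset.sup_le_iff]
      exact forall₂_congr fun x _ => (hasFreshTuple_iff H hX x).symm
    | inf =>
      have : Infinite U := hU
      exact iff_of_true (univGe_of_infinite U _) fun x _ => hasFreshTuple_of_infinite hk x
  obtain ⟨core, uLo, uHi, hMin, hMax⟩ := M
  simp only [domClosureU, BoolComb.holds_conj, List.mem_append, or_imp, forall_and,
    List.forall_mem_map, Option.mem_toList, List.forall_mem_cons, univGe, univLt, BoolComb.Holds,
    Test.Holds, h₁, and_assoc]
  refine and_congr_right fun _ => and_congr_right fun _ => and_congr_right fun _ => ?_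
  obtain ⟨hMin_ok, hMax_ok⟩ := hM
  rcases hMax with _ | b
  · simp [BoolComb.Holds]
  have hb : b.Ok d := hMax_ok b rfl
  cases hMin <;> cases b
  case num.num => simp [Bound.val, holds_truth]
  all_goals
    obtain rfl : d = .fin := by assumption
    have := hU.1
    simp [Bound.val, holds_truth, BoolComb.Holds, Test.Holds, univGe_iff]
    try omega

theorem domClosureU_all [DecidableEq V] {d : UnivKind} (M : Minterm k V) :
    (domClosureU M).All (Test.Ok d) := by
  obtain ⟨core, uLo, uHi, hMin, hMax⟩ := M
  simp only [domClosureU, BoolComb.all_conj, List.mem_append, or_imp, forall_and,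
    List.forall_mem_map, List.forall_mem_cons]
  refine ⟨⟨?_, ?_⟩, ?_, ?_, by simp⟩
  · exact fun _ _ => trivial
  · exact fun _ _ => trivial
  · trivial
  rcases hMax with _ | b
  · cases hMin <;> trivial
  · cases hMin <;> cases b <;> first | exact truth_all | trivial

end LiteralSets

/-! ### Elimination of the separating conjunction between two minterms -/

section Star

variable {k : ℕ} {V : Type v} {U : Type u} {s : V → U} {h : Heap k U} {d : UnivKind}
  {T T₁ T₂ : Finset (Literal (Atom k V))}

/-- The pair `(x, x)` already puts a literal mentioning `x` into `T`. Consequently two minterms that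
are E-complete for their joint variables have the same variables. -/
theorem EComplete.subset_fv [DecidableEq V] {X : Finset V} (hX : EComplete T X) : X ⊆ fv T := by
  intro x hx
  rcases hX x hx x hx with ⟨h₁, -⟩ | ⟨h₁, -⟩ <;>
    exact mem_fv h₁ (by simp [Literal.atom, Atom.vars])

/-- The two counts add up because a variable sharing its value with an allocated one is equivalent
to it, hence allocated too, which `Y` excludes. -/
theorem Separates.count_eq [DecidableEq V] {X Y : Finset V} (H : Separates s T X) (hX : fv T ⊆ X)
    (hX' : X ⊆ fv T) (hY : Y ⊆ X) (hYA : ∀ y ∈ Y, y ∉ avar T) :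
    allocNo T + classCount T Y = (s '' avar T ∪ s '' Y).ncard := by
  have hA : avar T ⊆ X := avar_subset.trans hX
  rw [allocNo, H.classCount_eq hA, H.classCount_eq hY, Set.ncard_union_eq]
  · rw [Set.disjoint_left]
    rintro _ ⟨x, hx, rfl⟩ ⟨y, hy, e⟩
    exact hYA y hy (mem_avar_of_eqv hx (H.2 x (hA hx) y (hY hy) e.symm) (hX' (hY hy)))

theorem lin_add {t t' : ℤ × ℤ} (h : d = .fin ∨ t.1 = 0) (h' : d = .fin ∨ t'.1 = 0) :
    d = .fin ∨ (t + t').1 = 0 := by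
  rcases h with h | h <;> rcases h' with h' | h' <;> simp [h, h']

theorem lin_sub {t t' : ℤ × ℤ} (h : d = .fin ∨ t.1 = 0) (h' : d = .fin ∨ t'.1 = 0) :
    d = .fin ∨ (t - t').1 = 0 := by
  rcases h with h | h <;> rcases h' with h' | h' <;> simp [h, h']

theorem holds_heapLtAddSubOne (hU : Fits d U) {b₁ b₂ : Option Bound} (h₁ : ∀ b ∈ b₁, b.Ok d)
    (h₂ : ∀ b ∈ b₂, b.Ok d) :
    (heapLtAddSubOne b₁ b₂ : BoolComb (Test k V)).Holds (Test.Holds s h) ↔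
      ∀ b ∈ b₁, ∀ b' ∈ b₂, h.card < b.val (Nat.card U) + b'.val (Nat.card U) - 1 := by
  rcases b₁ with _ | b₁
  · simp [heapLtAddSubOne, BoolComb.Holds]
  rcases b₂ with _ | b₂
  · simp [heapLtAddSubOne, BoolComb.Holds]
  have e₁ := Bound.lin_fst (h₁ b₁ rfl)
  have e₂ := Bound.lin_fst (h₂ b₂ rfl)
  simp only [heapLtAddSubOne, heapLtLin, BoolComb.Holds]
  rw [holds_heapGeLin hU (lin_sub (lin_add e₁ e₂) (Or.inr rfl))]
  simp [Bound.val_eq]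
  constructor <;> intro <;> linarith

theorem holds_etaStar [DecidableEq V] (hU : Fits d U) {M₁ M₂ : Minterm k V} (h₁ : M₁.Ok d)
    (h₂ : M₂.Ok d) : (etaStar M₁ M₂).Holds (Test.Holds s h) ↔
      ∀ Y ⊆ nvar M₂.core \ avar M₁.core, (∀ y ∈ Y, s y ∈ h.dom) →
        (allocNo M₁.core + classCount M₁.core Y : ℕ) + M₂.hMin.val (Nat.card U) ≤ h.card ∧
        ∀ b ∈ M₁.hMax,
          (allocNo M₁.core + classCount M₁.core Y : ℕ) < b.val (Nat.card U) := by
  simp only [etaStar, BoolComb.holds_conj, List.forall_mem_map, Finset.mem_toList,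
    Finset.mem_powerset, BoolComb.holds_imp, holds_allocAll]
  refine forall₃_congr fun Y _ _ => and_congr ?_ (holds_numLt hU _ h₁.2 h)
  rw [holds_heapGeLin hU (by simpa using Bound.lin_fst h₂.1)]
  simp [Bound.val_eq]
  constructor <;> intro <;> linarith

theorem elimStar_all [DecidableEq V] {M₁ M₂ : Minterm k V} (h₁ : M₁.Ok d) (h₂ : M₂.Ok d) :
    (elimStar M₁ M₂).All (Test.Ok d) := by
  have hη : ∀ {M₁ M₂ : Minterm k V}, M₂.Ok d → (etaStar M₁ M₂).All (Test.Ok d) := by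
    intro M₁ M₂ h₂
    simp only [etaStar, BoolComb.all_conj, List.forall_mem_map, BoolComb.all_imp]
    exact fun Y _ =>
      ⟨allocAll_all, heapGeLin_all (by simpa using Bound.lin_fst h₂.1), numLt_all _ _⟩
  have e₁ := Bound.lin_fst h₁.1
  have e₂ := Bound.lin_fst h₂.1
  simp only [elimStar, BoolComb.all_conj, List.forall_mem_cons, conjLits_all, domClosureU_all,
    nallocAll_all, hη h₁, hη h₂, List.forall_mem_map, true_and]
  refine ⟨fun _ _ => trivial, heapGeLin_all (lin_add e₁ e₂), ?_, by simp⟩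
  rcases e : M₁.hMax with _ | b₁
  · trivial
  rcases e' : M₂.hMax with _ | b₂
  · trivial
  have e₁ := Bound.lin_fst (h₁.2 b₁ e)
  have e₂ := Bound.lin_fst (h₂.2 b₂ e')
  exact heapGeLin_all (lin_sub (lin_add e₁ e₂) (Or.inr rfl))

/-- A set of literals holds in the restriction of a heap that contains the allocated variables,
avoids the others, and respects the negative points-to literals. -/
theorem coreHolds_restrict [DecidableEq V] {D : Set U} (heq : CoreHolds s h (eqPart T))
    (hfp : CoreHolds s h (aFootprint T)) (hA : ∀ x ∈ avar T, s x ∈ D)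
    (hN : ∀ x ∈ nvar T, s x ∈ h.dom → s x ∉ D)
    (hP : ∀ x y, .neg (.pto x y) ∈ T → x ∉ avar T → s x ∈ D →
      h.map (s x) ≠ some fun i => s (y i)) :
    CoreHolds s (h.restrict D) T := by
  have fp : ∀ l ∈ T, ∀ x ∈ avar T, l.atom.addr? = some x → l.Holds (Atom.Holds s h) :=
    fun l hl x hx e => hfp l (Finset.mem_filter.2 ⟨hl, x, hx, e⟩)
  rintro ((⟨x, y⟩ | x | ⟨x, y⟩) | (⟨x, y⟩ | x | ⟨x, y⟩)) hl
  · exact heq _ (mem_eqPart.2 ⟨hl, rfl⟩)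
  · have hx := mem_avar_of_alloc hl
    simp only [Literal.Holds, Atom.Holds, Heap.dom_restrict]
    exact ⟨fp _ hl x hx rfl, hA x hx⟩
  · have hx := mem_avar_of_pto hl
    simp only [Literal.Holds, Atom.Holds, Heap.restrict_map_of_mem (hA x hx)]
    exact fp _ hl x hx rfl
  · exact heq _ (mem_eqPart.2 ⟨hl, rfl⟩)
  · have hx := mem_nvar_of_alloc hl
    simp only [Literal.Holds, Atom.Holds, Heap.dom_restrict]
    exact fun H => hN x hx H.1 H.2
  · simp only [Literal.Holds, Atom.Holds]
    intro e
    have hD : s x ∈ D := by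
      have := Heap.mem_dom_of_map_eq_some e
      rw [Heap.dom_restrict] at this
      exact this.2
    rw [Heap.restrict_map_of_mem hD] at e
    -- A negative points-to literal on an allocated variable belongs to the footprint; the others
    -- are left to `hP`.
    by_cases hx : x ∈ avar T
    · exact fp _ hl x hx rfl e
    · exact hP x y hl hx hD e

/-- The closures agree, so `T₂` contains this literal or its complement; the complement would
allocate `x`. -/
theorem neg_pto_mem_of_complClosure_eq [DecidableEq V]
    (hc : complClosure (ptoPart T₁) = complClosure (ptoPart T₂)) {x : V} {y : Fin k → V}
    (hl : .neg (.pto x y) ∈ T₁) (hx : x ∉ avar T₂) : .neg (.pto x y) ∈ T₂ := by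
  have : .neg (.pto x y) ∈ complClosure (ptoPart T₂) := by
    rw [← hc]
    exact Finset.mem_union_left _ (Finset.mem_filter.2 ⟨hl, rfl⟩)
  rcases Finset.mem_union.1 this with h | h
  · exact (Finset.mem_filter.1 h).1
  · obtain ⟨l, hl, e⟩ := Finset.mem_image.1 h
    rcases l with l | l
    · obtain rfl : l = .pto x y := by simpa [Literal.compl] using e
      exact absurd (mem_avar_of_pto (Finset.mem_filter.1 hl).1) hx
    · simp [Literal.compl] at e

/-- The equivalence of the union is still sound for the store, and equality of values is reflected
by each of the two sets. Thus the union allocates no further variables. -/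
theorem notMem_avar_union [DecidableEq V] {X : Finset V} (h₁ : Separates s T₁ X)
    (h₂ : Separates s T₂ X) (f₁ : fv T₁ = X) (f₂ : fv T₂ = X) (e₁ : CoreHolds s h (eqPart T₁))
    (e₂ : CoreHolds s h (eqPart T₂)) {x : V} (hx₁ : x ∉ avar T₁) (hx₂ : x ∉ avar T₂) :
    x ∉ avar (T₁ ∪ T₂) := by
  intro hx
  obtain ⟨hx, x', e, hx'⟩ := mem_avar.1 hx
  have e' : s x = s x' := by
    refine Eqv.store_eq (h := h) ?_ e
    rw [show eqPart (T₁ ∪ T₂) = eqPart T₁ ∪ eqPart T₂ from Finset.filter_union _ _ _,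
      coreHolds_union]
    exact ⟨e₁, e₂⟩
  have hxX : x ∈ X := by
    obtain ⟨l, hl, hv⟩ := Finset.mem_biUnion.1 hx
    rcases Finset.mem_union.1 hl with hl | hl
    · exact f₁ ▸ mem_fv hl hv
    · exact f₂ ▸ mem_fv hl hv
  have key : ∀ {T : Finset (Literal (Atom k V))}, Separates s T X → fv T = X → x' ∈ avar T →
      x ∈ avar T := fun H f hx' => mem_avar_of_eqv hx'
        (H.2 x' (f ▸ avar_subset hx') x hxX e'.symm) (f ▸ hxX)
  have : x' ∈ avar T₁ ∨ x' ∈ avar T₂ := by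
    simp only [Finset.mem_union] at hx'
    rcases hx' with (hx' | hx') | ⟨y, hx' | hx'⟩
    · exact Or.inl (mem_avar_of_alloc hx')
    · exact Or.inr (mem_avar_of_alloc hx')
    · exact Or.inl (mem_avar_of_pto hx')
    · exact Or.inr (mem_avar_of_pto hx')
  rcases this with this | this
  · exact hx₁ (key h₁ f₁ this)
  · exact hx₂ (key h₂ f₂ this)

/-- The variables that one part of a heap allocates, and those excluded from the other part, give a
lower bound on the size of the former. -/
theorem count_le_card [DecidableEq V] {X Y : Finset V} {h₁ h₂ : Heap k U} (H : Separates s T₁ X)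
    (f₁ : fv T₁ = X) (f₂ : fv T₂ = X) (H₁ : CoreHolds s h₁ T₁) (H₂ : CoreHolds s h₂ T₂)
    (hY : Y ⊆ nvar T₂ \ avar T₁) (hY' : ∀ y ∈ Y, s y ∈ h₁.dom ∪ h₂.dom) :
    allocNo T₁ + classCount T₁ Y ≤ h₁.card := by
  rw [H.count_eq f₁.subset f₁.symm.subset
    (fun y hy => f₂ ▸ nvar_subset (Finset.mem_sdiff.1 (hY hy)).1)
    (fun y hy => (Finset.mem_sdiff.1 (hY hy)).2)]
  refine Set.ncard_le_ncard ?_ h₁.dom_finite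
  rintro _ (⟨x, hx, rfl⟩ | ⟨y, hy, rfl⟩)
  · exact H₁.mem_dom hx
  · exact (hY' y hy).resolve_right (H₂.notMem_dom (Finset.mem_sdiff.1 (hY hy)).1)

/-- The footprint of a part of a heap holds in the whole heap. -/
theorem coreHolds_aFootprint_of_map_eq [DecidableEq V] {h₁ : Heap k U} (H : CoreHolds s h₁ T)
    (hm : ∀ l ∈ h₁.dom, h.map l = h₁.map l) : CoreHolds s h (aFootprint T) := by
  intro l hl
  obtain ⟨hl, x, hx, e⟩ := Finset.mem_filter.1 hl
  have hd := H.mem_dom hx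
  have hl' := H l hl
  have hm := hm _ hd
  rcases l with (⟨x, y⟩ | x | ⟨x, y⟩) | (⟨x, y⟩ | x | ⟨x, y⟩) <;> cases e <;>
    simpa [Literal.Holds, Atom.Holds, Heap.mem_dom, hm] using hl'

theorem mem_negPto [DecidableEq V] {M₁ M₂ : Minterm k V} {l : Literal (Atom k V)} :
    l ∈ negPto M₁ M₂ ↔ l ∈ M₁.core ∧ l ∈ M₂.core ∧
      ∃ x y, l = .neg (.pto x y) ∧ x ∉ avar (M₁.core ∪ M₂.core) := by
  simp [negPto, and_assoc]

/-- The number `e` has lower bounds c₁, m₁, n - b₂ + 1 and upper bounds n - c₂, n - m₂, b₁ - 1. The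
nine hypotheses are the nine comparisons between them, so the largest lower bound is a solution. An
infinite b₁ or b₂ removes its bound. -/
theorem exists_between_bounds {u : ℕ} {n c₁ c₂ m₁ m₂ : ℤ} {b₁ b₂ : Option Bound} (hc : c₁ + c₂ ≤ n)
    (h₁ : ∀ b ∈ b₁, c₁ < b.val u) (h₂ : ∀ b ∈ b₂, c₂ < b.val u) (h₃ : c₁ + m₂ ≤ n)
    (h₄ : c₂ + m₁ ≤ n) (h₅ : ∀ b ∈ b₁, m₁ < b.val u) (h₆ : ∀ b ∈ b₂, m₂ < b.val u)
    (h₇ : m₁ + m₂ ≤ n) (h₈ : ∀ b ∈ b₁, ∀ b' ∈ b₂, n < b.val u + b'.val u - 1) :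
    ∃ e : ℤ, c₁ ≤ e ∧ e ≤ n - c₂ ∧ m₁ ≤ e ∧ (∀ b ∈ b₁, e < b.val u) ∧ m₂ ≤ n - e ∧
      ∀ b ∈ b₂, n - e < b.val u := by
  rcases b₂ with _ | b₂
  · refine ⟨max c₁ m₁, by omega, by omega, by omega, fun b hb => ?_, by omega, by simp⟩
    have := h₁ b hb; have := h₅ b hb; omega
  · have h₂ := h₂ b₂ rfl
    have h₆ := h₆ b₂ rfl
    refine ⟨max (max c₁ m₁) (n - b₂.val u + 1), by omega, by omega, by omega, fun b hb => ?_,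
      by omega, fun b hb => ?_⟩
    · have := h₁ b hb; have := h₅ b hb; have := h₈ b hb b₂ rfl; omega
    · obtain rfl : b₂ = b := by simpa using hb
      omega

theorem holds_elimStar_iff [DecidableEq V] (hU : Fits d U) (hk : 0 < k) {M₁ M₂ : Minterm k V}
    (ok₁ : M₁.Ok d) (ok₂ : M₂.Ok d) (hR : StarReady M₁ M₂) (h : Heap k U) :
    (elimStar M₁ M₂).Holds (Test.Holds s h) ↔ ∃ h₁ h₂ : Heap k U, h₁.Disj h₂ ∧ h = h₁.union h₂ ∧
      M₁.Models s h₁ ∧ M₂.Models s h₂ := by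
  obtain ⟨fc₁, fc₂, ec₁, ec₂, hc⟩ := hR
  have f₁ : fv M₁.core = fv (M₁.core ∪ M₂.core) :=
    (fv_mono Finset.subset_union_left).antisymm ec₁.subset_fv
  have f₂ : fv M₂.core = fv (M₁.core ∪ M₂.core) :=
    (fv_mono Finset.subset_union_right).antisymm ec₂.subset_fv
  have sum_iff : (heapGeLin (M₁.hMin.lin + M₂.hMin.lin) : BoolComb (Test k V)).Holds
      (Test.Holds s h) ↔ M₁.hMin.val (Nat.card U) + M₂.hMin.val (Nat.card U) ≤ h.card := by
    rw [holds_heapGeLin hU (lin_add (Bound.lin_fst ok₁.1) (Bound.lin_fst ok₂.1))]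
    simp [Bound.val_eq]
    constructor <;> intro <;> linarith
  simp only [elimStar, BoolComb.holds_conj, List.forall_mem_cons, holds_conjLits, sum_iff,
    holds_heapLtAddSubOne hU ok₁.2 ok₂.2, holds_etaStar hU ok₁ ok₂, holds_etaStar hU ok₂ ok₁,
    holds_nallocAll, List.forall_mem_map, Finset.mem_toList, Finset.mem_product]
  simp only [List.not_mem_nil, false_imp_iff, implies_true, and_true]
  generalize hX : fv (M₁.core ∪ M₂.core) = X at *
  constructor
  · rintro ⟨q₁, q₂, dc₁, dc₂, hne, fp₁, fp₂, hn, hnp, hmin, hmax, η₁, η₂⟩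
    have s₁ := ec₁.separates q₁
    have s₂ := ec₂.separates q₂
    rw [holds_domClosureU hU hk ok₁ s₁ f₁.subset] at dc₁
    rw [holds_domClosureU hU hk ok₂ s₂ f₂.subset] at dc₂
    classical
    -- Of all instances of η only the largest applicable one is needed: every variable that the
    -- other part forbids and h nevertheless allocates.
    set Y₁ := (nvar M₂.core \ avar M₁.core).filter fun y => s y ∈ h.dom with hY₁
    set Y₂ := (nvar M₁.core \ avar M₂.core).filter fun y => s y ∈ h.dom with hY₂
    have hY₁X : ∀ y ∈ Y₁, y ∈ nvar M₂.core ∧ y ∉ avar M₁.core ∧ s y ∈ h.dom := by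
      simp [hY₁, and_assoc]
    have hY₂X : ∀ y ∈ Y₂, y ∈ nvar M₁.core ∧ y ∉ avar M₂.core ∧ s y ∈ h.dom := by
      simp [hY₂, and_assoc]
    obtain ⟨η₁, η₁'⟩ := η₁ Y₁ (Finset.filter_subset _ _) fun y hy => (hY₁X y hy).2.2
    obtain ⟨η₂, η₂'⟩ := η₂ Y₂ (Finset.filter_subset _ _) fun y hy => (hY₂X y hy).2.2
    have c₁ := s₁.count_eq f₁.subset f₁.symm.subset
      (fun y hy => f₂ ▸ nvar_subset (hY₁X y hy).1) fun y hy => (hY₁X y hy).2.1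
    have c₂ := s₂.count_eq f₂.subset f₂.symm.subset
      (fun y hy => f₁ ▸ nvar_subset (hY₂X y hy).1) fun y hy => (hY₂X y hy).2.1
    -- `C₁` is forced into the first part and `C₂` into the second.
    set C₁ := s '' avar M₁.core ∪ s '' Y₁
    set C₂ := s '' avar M₂.core ∪ s '' Y₂
    have allocated : ∀ {T : Finset (Literal (Atom k V))}, CoreHolds s h (eqPart T) →
        CoreHolds s h (aFootprint T) → ∀ x ∈ avar T, s x ∈ h.dom := by
      intro T q fp x hx
      obtain ⟨hx', x', e, hl⟩ := mem_avar.1 hx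
      rw [Eqv.store_eq q e]
      rcases hl with hl | ⟨y, hl⟩
      · exact fp _ (Finset.mem_filter.2 ⟨hl, x', mem_avar_of_alloc hl, rfl⟩)
      · exact Heap.mem_dom_of_map_eq_some
          (fp _ (Finset.mem_filter.2 ⟨hl, x', mem_avar_of_pto hl, rfl⟩))
    have hC₁ : C₁ ⊆ h.dom := by
      rintro _ (⟨x, hx, rfl⟩ | ⟨x, hx, rfl⟩)
      · exact allocated q₁ fp₁ x hx
      · exact (hY₁X x hx).2.2
    have hC₂ : C₂ ⊆ h.dom := by
      rintro _ (⟨x, hx, rfl⟩ | ⟨x, hx, rfl⟩)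
      · exact allocated q₂ fp₂ x hx
      · exact (hY₂X x hx).2.2
    have an : ∀ {T : Finset (Literal (Atom k V))}, FootprintConsistent T → Separates s T X →
        fv T = X → ∀ x ∈ avar T, ∀ y ∈ nvar T, s x ≠ s y := fun fc H f x hx y hy e =>
      fc.notMem_nvar (mem_avar_of_eqv hx (H.2 x (f ▸ avar_subset hx) y (f ▸ nvar_subset hy) e)
        (nvar_subset hy)) hy
    -- The four cases use, in order, the disequalities between allocated variables, consistency of
    -- `M₁`, consistency of `M₂`, and the ban on allocating what both minterms forbid.
    have hCC : Disjoint C₁ C₂ := by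
      rw [Set.disjoint_left]
      rintro _ (⟨x, hx, rfl⟩ | ⟨x, hx, rfl⟩) (⟨y, hy, e⟩ | ⟨y, hy, e⟩)
      · exact hne (x, y) ⟨hx, hy⟩ e.symm
      · exact an fc₁ s₁ f₁ x hx y (hY₂X y hy).1 e.symm
      · exact an fc₂ s₂ f₂ y hy x (hY₁X x hx).1 e
      · have hx' := hY₁X x hx
        have hy' := hY₂X y hy
        have hxX : x ∈ X := f₂ ▸ nvar_subset hx'.1
        have : x ∈ nvar M₁.core := mem_nvar_of_eqv hy'.1
          (s₁.2 y (f₁ ▸ nvar_subset hy'.1) x hxX e) (f₁ ▸ hxX)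
        exact hn x (Finset.mem_inter.2 ⟨this, hx'.1⟩) hx'.2.2
    have hcc : C₁.ncard + C₂.ncard ≤ h.card := by
      rw [← Set.ncard_union_eq hCC (h.dom_finite.subset hC₁) (h.dom_finite.subset hC₂)]
      exact Set.ncard_le_ncard (Set.union_subset hC₁ hC₂) h.dom_finite
    rw [c₁] at η₁ η₁'
    rw [c₂] at η₂ η₂'
    obtain ⟨e, he₁, he₂, he₃, he₄, he₅, he₆⟩ := exists_between_bounds (u := Nat.card U)
      (n := h.card) (by exact_mod_cast hcc) η₁' η₂' η₁ η₂ dc₁.2.2.2 dc₂.2.2.2 hmin hmax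
    -- `D` has size `e` and lies between `C₁` and the domain without `C₂`; `toNat` loses nothing
    -- because `e` is at least |C₁|.
    obtain ⟨D, hCD, hDC, hDe⟩ := Set.exists_subsuperset_card_eq (n := e.toNat)
      (Set.subset_sdiff.2 ⟨hC₁, hCC⟩) (by omega)
      (by rw [Set.ncard_sdiff hC₂ (h.dom_finite.subset hC₂)]; change _ ≤ h.card - _; omega)
    have hD : D ⊆ h.dom := hDC.trans Set.sdiff_subset
    have card₁ : (h.restrict D).card = e.toNat := by
      rw [Heap.card, Heap.dom_restrict, Set.inter_eq_right.2 hD, hDe]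
    have hcard := Heap.card_union (Heap.disj_restrict_compl (h := h) D)
    rw [Heap.restrict_union_compl, card₁] at hcard
    -- A negative points-to literal on a variable allocated by neither minterm is common to both by
    -- equality of the closures, so the formula asserts it for the whole heap.
    have neg_pto : ∀ x y, x ∉ avar M₁.core → x ∉ avar M₂.core →
        .neg (.pto x y) ∈ M₁.core → .neg (.pto x y) ∈ M₂.core →
        h.map (s x) ≠ some fun i => s (y i) := fun x y hx₁ hx₂ hl₁ hl₂ =>
      hnp (.neg (.pto x y)) (mem_negPto.2 ⟨hl₁, hl₂, x, y, rfl,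
        notMem_avar_union s₁ s₂ f₁ f₂ q₁ q₂ hx₁ hx₂⟩)
    refine ⟨_, _, Heap.disj_restrict_compl D, (Heap.restrict_union_compl D).symm,
      (Minterm.models_iff hU ok₁ _).2 ⟨coreHolds_restrict q₁ fp₁ ?_ ?_ ?_, dc₁.1, dc₁.2.1, ?_, ?_⟩,
      (Minterm.models_iff hU ok₂ _).2 ⟨coreHolds_restrict q₂ fp₂ ?_ ?_ ?_, dc₂.1, dc₂.2.1, ?_, ?_⟩⟩
    · exact fun x hx => hCD (Or.inl ⟨x, hx, rfl⟩)
    · intro x hx hxd hxD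
      by_cases hxA : x ∈ avar M₂.core
      · exact (hDC hxD).2 (Or.inl ⟨x, hxA, rfl⟩)
      · exact (hDC hxD).2 (Or.inr ⟨x, by simp [hY₂, hx, hxA, hxd], rfl⟩)
    · intro x y hl hx hxD
      have hx₂ : x ∉ avar M₂.core := fun hx₂ => (hDC hxD).2 (Or.inl ⟨x, hx₂, rfl⟩)
      exact neg_pto x y hx hx₂ hl (neg_pto_mem_of_complClosure_eq hc hl hx₂)
    · omega
    · intro b hb
      have := he₄ b hb
      omega
    · exact fun x hx hxD => (hDC hxD).2 (Or.inl ⟨x, hx, rfl⟩)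
    · intro x hx hxd hxD
      by_cases hxA : x ∈ avar M₁.core
      · exact hxD (hCD (Or.inl ⟨x, hxA, rfl⟩))
      · exact hxD (hCD (Or.inr ⟨x, by simp [hY₁, hx, hxA, hxd], rfl⟩))
    · intro x y hl hx hxD
      have hx₁ : x ∉ avar M₁.core := fun hx₁ => hxD (hCD (Or.inl ⟨x, hx₁, rfl⟩))
      exact neg_pto x y hx₁ hx (neg_pto_mem_of_complClosure_eq hc.symm hl hx₁) hl
    · omega
    · intro b hb
      have := he₆ b hb
      omega
  · rintro ⟨h₁, h₂, hd, rfl, H₁, H₂⟩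
    rw [Minterm.models_iff hU ok₁] at H₁
    rw [Minterm.models_iff hU ok₂] at H₂
    obtain ⟨H₁, lo₁, hi₁, min₁, max₁⟩ := H₁
    obtain ⟨H₂, lo₂, hi₂, min₂, max₂⟩ := H₂
    have q₁ := coreHolds_mono H₁ eqPart_subset
    have q₂ := coreHolds_mono H₂ eqPart_subset
    have s₁ := ec₁.separates q₁
    have s₂ := ec₂.separates q₂
    rw [Heap.card_union hd]
    rw [holds_domClosureU hU hk ok₁ s₁ f₁.subset, holds_domClosureU hU hk ok₂ s₂ f₂.subset]
    refine ⟨coreHolds_eqPart_congr q₁, coreHolds_eqPart_congr q₂,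
      ⟨lo₁, hi₁, fun x hx => H₁.hasFreshTuple hx, fun b hb => min₁.trans_lt (max₁ b hb)⟩,
      ⟨lo₂, hi₂, fun x hx => H₂.hasFreshTuple hx, fun b hb => min₂.trans_lt (max₂ b hb)⟩,
      ?_, ?_, ?_, ?_, ?_, ?_, ?_, ?_, ?_⟩
    · exact fun p hp e => Set.disjoint_left.1 hd (H₁.mem_dom hp.1)
        (show s p.1 ∈ h₂.dom from (show s p.1 = s p.2 from e) ▸ H₂.mem_dom hp.2)
    · exact coreHolds_aFootprint_of_map_eq H₁ fun l hl => Heap.union_map_of_mem_left hd hl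
    · exact coreHolds_aFootprint_of_map_eq H₂ fun l hl => Heap.union_map_of_mem_right hd hl
    · intro x hx
      obtain ⟨hx₁, hx₂⟩ := Finset.mem_inter.1 hx
      rw [Heap.dom_union]
      rintro (hx | hx)
      exacts [H₁.notMem_dom hx₁ hx, H₂.notMem_dom hx₂ hx]
    · intro l hl
      obtain ⟨hl₁, hl₂, x, y, rfl, -⟩ := mem_negPto.1 hl
      have hl₁ := H₁ _ hl₁
      have hl₂ := H₂ _ hl₂
      simp only [Literal.Holds, Atom.Holds] at hl₁ hl₂ ⊢
      by_cases hx : s x ∈ h₁.dom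
      · rwa [Heap.union_map_of_mem_left hd hx]
      · rwa [Heap.union_map_of_notMem_left hx]
    · push_cast; linarith
    · intro b hb b' hb'
      have := max₁ b hb
      have := max₂ b' hb'
      push_cast; linarith
    · intro Y hY hYd
      have := count_le_card s₁ f₁ f₂ H₁ H₂ hY fun y hy => by simpa [Heap.dom_union] using hYd y hy
      refine ⟨by push_cast at *; linarith, fun b hb => ?_⟩
      have := max₁ b hb
      omega
    · intro Y hY hYd
      have := count_le_card s₂ f₂ f₁ H₂ H₁ hY fun y hy => by
        simpa [Heap.dom_union, or_comm] using hYd y hy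
      refine ⟨by push_cast at *; linarith, fun b hb => ?_⟩
      have := max₂ b hb
      omega

end Star

/-! ### Elimination of septraction between two minterms -/

section Sept

variable {k : ℕ} {V : Type v} {U : Type u} {s : V → U} {h : Heap k U} {d : UnivKind}
  {T T₁ T₂ : Finset (Literal (Atom k V))}

theorem holds_heapGeSubAddOne (hU : Fits d U) {b₁ : Bound} {b₂ : Option Bound} (h₁ : b₁.Ok d)
    (h₂ : ∀ b ∈ b₂, b.Ok d) :
    (heapGeSubAddOne b₁ b₂ : BoolComb (Test k V)).Holds (Test.Holds s h) ↔
      ∀ b ∈ b₂, b₁.val (Nat.card U) - b.val (Nat.card U) + 1 ≤ h.card := by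
  rcases b₂ with _ | b₂
  · simp [heapGeSubAddOne, BoolComb.Holds]
  have e₁ := Bound.lin_fst h₁
  have e₂ := Bound.lin_fst (h₂ b₂ rfl)
  simp only [heapGeSubAddOne]
  rw [holds_heapGeLin hU (lin_add (lin_sub e₁ e₂) (Or.inr rfl))]
  simp [Bound.val_eq]
  constructor <;> intro <;> linarith

theorem holds_heapLtSub (hU : Fits d U) {b₁ : Option Bound} {b₂ : Bound}
    (h₁ : ∀ b ∈ b₁, b.Ok d) (h₂ : b₂.Ok d) :
    (heapLtSub b₁ b₂ : BoolComb (Test k V)).Holds (Test.Holds s h) ↔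
      ∀ b ∈ b₁, h.card < b.val (Nat.card U) - b₂.val (Nat.card U) := by
  rcases b₁ with _ | b₁
  · simp [heapLtSub, BoolComb.Holds]
  have e₁ := Bound.lin_fst (h₁ b₁ rfl)
  have e₂ := Bound.lin_fst h₂
  simp only [heapLtSub, heapLtLin, BoolComb.Holds]
  rw [holds_heapGeLin hU (lin_sub e₁ e₂)]
  simp [Bound.val_eq]
  constructor <;> intro <;> linarith

theorem heapLtSub_all {b₁ : Option Bound} {b₂ : Bound} (h₁ : ∀ b ∈ b₁, b.Ok d) (h₂ : b₂.Ok d) :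
    (heapLtSub b₁ b₂ : BoolComb (Test k V)).All (Test.Ok d) := by
  rcases b₁ with _ | b₁
  · trivial
  · exact heapGeLin_all (lin_sub (Bound.lin_fst (h₁ b₁ rfl)) (Bound.lin_fst h₂))

theorem holds_univGeAdd [Finite U] (b : Bound) (c : ℕ) :
    (univGeAdd b c : BoolComb (Test k V)).Holds (Test.Holds s h) ↔
      b.val (Nat.card U) + c ≤ Nat.card U := by
  cases b with
  | num n =>
    simp only [univGeAdd, univGe, BoolComb.Holds, Test.Holds, univGe_iff, Bound.val]
    omega
  | univSub n =>
    refine holds_truth.trans ?_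
    simp only [Bound.val]
    omega

theorem holds_ptoClosureE {M : Minterm k V} : (ptoClosureE M).Holds (Test.Holds s h) ↔
    ¬ PtoConflict M.core ∧ CoreHolds s h (eqPart M.core) := by
  by_cases hM : PtoConflict M.core <;> simp [ptoClosureE, hM, BoolComb.Holds, holds_conjLits]

theorem ptoClosureE_all {M : Minterm k V} : (ptoClosureE M).All (Test.Ok d) := by
  by_cases hM : PtoConflict M.core <;> simp [ptoClosureE, hM, BoolComb.All, conjLits_all]

theorem holds_lambdaSept [DecidableEq V] (hU : Fits d U) {M₁ M₂ : Minterm k V} :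
    (lambdaSept d M₁ M₂).Holds (Test.Holds s h) ↔ (Finite U →
      ∀ Y ⊆ fv (M₁.core ∪ M₂.core), (∀ y ∈ Y, s y ∉ h.dom) →
        h.card + M₁.hMin.val (Nat.card U) + nallocNo Y M₁.core ≤ Nat.card U ∧
        M₂.hMin.val (Nat.card U) + nallocNo Y M₁.core ≤ Nat.card U) := by
  cases d with
  | inf =>
    have : Infinite U := hU
    simp only [lambdaSept, BoolComb.Holds, true_iff]
    exact fun hf => (hf.not_infinite this).elim
  | fin =>
    have := hU.1
    simp only [lambdaSept, BoolComb.holds_conj, List.forall_mem_map, Finset.mem_toList,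
      Finset.mem_powerset, BoolComb.holds_imp, holds_nallocAll, this, true_imp_iff]
    refine forall₃_congr fun Y _ _ => and_congr ?_ (holds_univGeAdd _ _)
    rw [heapLtLin, BoolComb.Holds, holds_heapGeLin hU (Or.inl rfl)]
    simp [Bound.val_eq]
    constructor <;> intro <;> linarith

theorem elimSept_all [DecidableEq V] {M₁ M₂ : Minterm k V} (h₁ : M₁.Ok d) (h₂ : M₂.Ok d) :
    (elimSept d M₁ M₂).All (Test.Ok d) := by
  simp only [elimSept, BoolComb.all_conj, List.forall_mem_cons, ptoClosureE_all, conjLits_all,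
    domClosureU_all, nallocAll_all, heapLtSub_all h₂.2 h₁.1, numLt_all, true_and,
    heapLtSub_all h₂.2 (show (Bound.num (allocNo M₁.core)).Ok d from trivial)]
  refine ⟨?_, ?_, by simp⟩
  · rcases e : M₁.hMax with _ | b
    · trivial
    · exact heapGeLin_all
        (lin_add (lin_sub (Bound.lin_fst h₂.1) (Bound.lin_fst (h₁.2 b e))) (Or.inr rfl))
  · cases d with
    | inf => trivial
    | fin => exact BoolComb.All.of_forall Test.ok_fin _

/-- A tuple that can be stored at `x` without violating the points-to literals of `T`. -/
theorem exists_admissible_tuple [DecidableEq V] {X : Finset V} (fc : FootprintConsistent T)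
    (ec : EComplete T X) (hs : Separates s T X) (hX : fv T ⊆ X) (hp : ¬ PtoConflict T) {x : V}
    (hf : HasFreshTuple s T x) : ∃ t : Fin k → U,
      (∀ x' y, Eqv T x x' → .pos (.pto x' y) ∈ T → t = fun i => s (y i)) ∧
      ∀ x' y, Eqv T x x' → .neg (.pto x' y) ∈ T → t ≠ fun i => s (y i) := by
  -- A positive literal dictates the tuple: absence of conflict reconciles it with the other
  -- positive ones, footprint-consistency with the negative ones. Without a positive literal the
  -- fresh tuple serves.
  by_cases H : ∃ x' y, Eqv T x x' ∧ .pos (.pto x' y) ∈ T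
  · obtain ⟨x₁, y₁, e₁, hl₁⟩ := H
    refine ⟨fun i => s (y₁ i), fun x₂ y₂ e₂ hl₂ => funext fun i => ?_, fun x₂ y₂ e₂ hl₂ e => ?_⟩
    · by_contra hne
      refine hp ⟨x₁, x₂, y₁, y₂, hl₁, hl₂, e₁.symm.trans e₂, i, ec.notEqv
        (hX ((mem_fv_of_pto hl₁).2 i)) (hX ((mem_fv_of_pto hl₂).2 i)) fun e => hne (hs.1 _ _ e)⟩
    · exact ((fc x₁ x₂ y₁ y₂ (e₁.symm.trans e₂) fun i => hs.2 _ (hX ((mem_fv_of_pto hl₁).2 i)) _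
        (hX ((mem_fv_of_neg_pto hl₂).2 i)) (congrFun e i)).2 hl₁).2 hl₂
  · obtain ⟨t, ht⟩ := hf
    exact ⟨t, fun x' y e hl => absurd ⟨x', y, e, hl⟩ H, ht⟩

/-- A finite set has infinite complement in an infinite universe, so room has to be assumed only
when U is finite. -/
theorem exists_finset_disjoint {W : Set U} (hW : W.Finite) (n : ℕ)
    (hn : Finite U → W.ncard + n ≤ Nat.card U) :
    ∃ E : Finset U, E.card = n ∧ ∀ l ∈ E, l ∉ W := by
  rcases finite_or_infinite U with hU | hU
  · have := hn hU
    have hc := Set.ncard_add_ncard_compl W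
    obtain ⟨E, hE, hc⟩ := Set.exists_subset_card_eq (s := Wᶜ) (n := n) (by omega)
    refine ⟨(Set.toFinite E).toFinset, ?_, fun l hl => hE (by simpa using hl)⟩
    rw [← Set.ncard_eq_toFinset_card E]
    exact hc
  · obtain ⟨E, hE, hc⟩ := Set.Infinite.exists_subset_card_eq hW.infinite_compl n
    exact ⟨E, hc, fun l hl => hE hl⟩

/-- A literal about the heap cell of `x` depends only on that cell. -/
theorem Literal.holds_congr_of_map_eq {h h' : Heap k U} {l : Literal (Atom k V)} {x : V}
    (hx : l.atom.addr? = some x) (hm : h.map (s x) = h'.map (s x)) :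
    l.Holds (Atom.Holds s h) ↔ l.Holds (Atom.Holds s h') := by
  rcases l with (⟨x, y⟩ | x | ⟨x, y⟩) | (⟨x, y⟩ | x | ⟨x, y⟩) <;> cases hx <;>
    simp [Literal.Holds, Atom.Holds, Heap.mem_dom, hm]

theorem holds_elimSept_iff [DecidableEq V] (hU : Fits d U) (hk : 0 < k) {M₁ M₂ : Minterm k V}
    (ok₁ : M₁.Ok d) (ok₂ : M₂.Ok d) (hR : SeptReady M₁ M₂) (h : Heap k U) :
    (elimSept d M₁ M₂).Holds (Test.Holds s h) ↔ ∃ h' : Heap k U, h'.Disj h ∧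
      M₁.Models s h' ∧ M₂.Models s (h'.union h) := by
  obtain ⟨fc₁, fc₂, ec₁, ec₂, ac, hsub, hfp⟩ := hR
  have f₁ : fv M₁.core = fv (M₁.core ∪ M₂.core) :=
    (fv_mono Finset.subset_union_left).antisymm ec₁.subset_fv
  have f₂ : fv M₂.core = fv (M₁.core ∪ M₂.core) :=
    (fv_mono Finset.subset_union_right).antisymm ec₂.subset_fv
  simp only [elimSept, BoolComb.holds_conj, List.forall_mem_cons, holds_conjLits,
    holds_ptoClosureE, holds_nallocAll, holds_heapGeSubAddOne hU ok₂.1 ok₁.2,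
    holds_heapLtSub hU ok₂.2 ok₁.1, holds_lambdaSept hU, holds_numLt hU _ ok₁.2,
    holds_heapLtSub hU ok₂.2 (show (Bound.num (allocNo M₁.core)).Ok d from trivial)]
  simp only [List.not_mem_nil, false_imp_iff, implies_true, and_true]
  generalize hX : fv (M₁.core ∪ M₂.core) = X at *
  constructor
  · rintro ⟨⟨hp, q₁⟩, q₂, dc₁, dc₂, hn, fp, hge, hlt, hlam, ha₁, ha₂⟩
    have s₁ := ec₁.separates q₁
    have s₂ := ec₂.separates q₂
    rw [holds_domClosureU hU hk ok₁ s₁ f₁.subset] at dc₁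
    rw [holds_domClosureU hU hk ok₂ s₂ f₂.subset] at dc₂
    classical
    -- λ is used only for this largest `Y`. `W` is what the padding must avoid: h, the cells `A` of
    -- the allocated variables, and the unallocated values of forbidden variables.
    set Y := X.filter fun x => s x ∉ h.dom with hY
    set A := (avar M₁.core).image s with hA
    set W := h.dom ∪ A ∪ s '' (Y ∩ nvar M₁.core : Finset V) with hW
    have hAcard : A.card = allocNo M₁.core := by
      rw [allocNo, s₁.classCount_eq (avar_subset.trans f₁.subset), ← Finset.coe_image,
        Set.ncard_coe_finset]
    have hYcard : nallocNo Y M₁.core = (s '' (Y ∩ nvar M₁.core : Finset V)).ncard :=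
      s₁.classCount_eq (Finset.inter_subset_left.trans (Finset.filter_subset _ _))
    have hWcard : W.ncard ≤ h.card + A.card + nallocNo Y M₁.core := by
      refine (Set.ncard_union_le _ _).trans (Nat.add_le_add ((Set.ncard_union_le _ _).trans ?_)
        hYcard.ge)
      rw [Set.ncard_coe_finset]; rfl
    have hWfin : W.Finite :=
      (h.dom_finite.union A.finite_toSet).union ((Finset.finite_toSet _).image s)
    -- The least conceivable size of `h'`: it holds the variables that `M₁` allocates, reaches the
    -- minimum of `M₁`, and brings the union up to the minimum of `M₂`.
    set e : ℤ := max (max (allocNo M₁.core) (M₁.hMin.val (Nat.card U)))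
      (M₂.hMin.val (Nat.card U) - h.card) with he
    obtain ⟨E, hEcard, hE⟩ := exists_finset_disjoint hWfin (e - allocNo M₁.core).toNat (by
      intro hfin
      obtain ⟨l₁, l₂⟩ := hlam hfin Y (Finset.filter_subset _ _) (by simp [hY])
      -- This settles the case where no padding is needed; the two halves of λ settle the other two
      -- values of the maximum.
      have hle : W.ncard ≤ Nat.card U := by
        rw [← Set.ncard_univ]; exact Set.ncard_le_ncard (Set.subset_univ _)
      omega)
    -- Tuples are chosen per location, so that aliases share one. Padding locations carry no
    -- constraint and accept any tuple.
    have hex : ∀ l : U, ∃ t : Fin k → U, ∀ x ∈ avar M₁.core, s x = l →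
        (∀ y, .pos (.pto x y) ∈ M₁.core → t = fun i => s (y i)) ∧
        ∀ y, .neg (.pto x y) ∈ M₁.core → t ≠ fun i => s (y i) := by
      intro l
      by_cases hl : ∃ x ∈ avar M₁.core, s x = l
      · obtain ⟨x, hx, rfl⟩ := hl
        obtain ⟨t, h₁, h₂⟩ :=
          exists_admissible_tuple fc₁ ec₁ s₁ f₁.subset hp (dc₁.2.2.1 x hx)
        refine ⟨t, fun x' hx' e => ?_⟩
        have e' := s₁.2 x (f₁ ▸ avar_subset hx) x' (f₁ ▸ avar_subset hx') e.symm
        exact ⟨fun y => h₁ x' y e', fun y => h₂ x' y e'⟩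
      · exact ⟨fun _ => l, fun x hx e => absurd ⟨x, hx, e⟩ hl⟩
    choose f hf using hex
    set h' : Heap k U := Heap.ofFinset (A ∪ E) f with hh'
    have hAE : Disjoint A E :=
      Finset.disjoint_left.2 fun l hl hl' => hE l hl' (Or.inl (Or.inr hl))
    have hcard : (h'.card : ℤ) = e := by
      rw [hh', Heap.card_ofFinset, Finset.card_union_of_disjoint hAE, hAcard, hEcard]
      omega
    have memA : ∀ x ∈ avar M₁.core, s x ∈ A := fun x hx => Finset.mem_image_of_mem s hx
    have dom_h' : h'.dom = (A ∪ E : Finset U) := Heap.dom_ofFinset _ _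
    have map_h' : ∀ x ∈ avar M₁.core, h'.map (s x) = some (f (s x)) := fun x hx =>
      Heap.ofFinset_map_of_mem (Finset.mem_union_left _ (memA x hx))
    have dom_avar : ∀ x ∈ avar M₁.core, s x ∈ h'.dom := fun x hx =>
      Heap.mem_dom_of_map_eq_some (map_h' x hx)
    have dom_nvar : ∀ x ∈ nvar M₁.core, s x ∉ h'.dom := by
      intro x hx hxd
      have hxX : x ∈ X := f₁ ▸ nvar_subset hx
      rw [dom_h', Finset.mem_coe, Finset.mem_union] at hxd
      rcases hxd with hxd | hxd
      · obtain ⟨x', hx', e⟩ := Finset.mem_image.1 hxd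
        exact fc₁.notMem_nvar (mem_avar_of_eqv hx' (s₁.2 x' (f₁ ▸ avar_subset hx') x hxX e)
          (nvar_subset hx)) hx
      · by_cases hxh : s x ∈ h.dom
        · exact hE _ hxd (Or.inl (Or.inl hxh))
        · exact hE _ hxd (Or.inr ⟨x, by simp [hY, hxX, hxh, hx], rfl⟩)
    have hd : h'.Disj h := by
      rw [Heap.Disj, Set.disjoint_left, dom_h']
      intro l hl hlh
      rcases Finset.mem_union.1 hl with hl | hl
      · obtain ⟨x, hx, rfl⟩ := Finset.mem_image.1 hl
        exact hn x hx hlh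
      · exact hE l hl (Or.inl (Or.inl hlh))
    have avar_or_nvar : ∀ x ∈ X, x ∈ avar M₁.core ∨ x ∈ nvar M₁.core := by
      intro x hx
      rcases ac x hx with ⟨h₁, -⟩ | ⟨h₁, -⟩
      exacts [Or.inl (mem_avar_of_alloc h₁), Or.inr (mem_nvar_of_alloc h₁)]
    have core₁ : CoreHolds s h' M₁.core := by
      rintro ((⟨x, y⟩ | x | ⟨x, y⟩) | (⟨x, y⟩ | x | ⟨x, y⟩)) hl
      · exact q₁ _ (mem_eqPart.2 ⟨hl, rfl⟩)
      · exact dom_avar x (mem_avar_of_alloc hl)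
      · have hx := mem_avar_of_pto hl
        simp only [Literal.Holds, Atom.Holds, map_h' x hx]
        exact congrArg some ((hf _ x hx rfl).1 y hl)
      · exact q₁ _ (mem_eqPart.2 ⟨hl, rfl⟩)
      · exact dom_nvar x (mem_nvar_of_alloc hl)
      · simp only [Literal.Holds, Atom.Holds]
        intro hm
        rcases avar_or_nvar x (f₁ ▸ (mem_fv_of_neg_pto hl).1) with hx | hx
        · rw [map_h' x hx] at hm
          exact (hf _ x hx rfl).2 y hl (Option.some.inj hm)
        · exact dom_nvar x hx (Heap.mem_dom_of_map_eq_some hm)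
    have core₂ : CoreHolds s (h'.union h) M₂.core := by
      intro l hl
      rcases ha : l.atom.addr? with _ | x
      · refine coreHolds_eqPart_congr q₂ l (mem_eqPart.2 ⟨hl, ?_⟩)
        cases h : l.atom <;> simp_all [Atom.addr?, Atom.isEq]
      · have hxX : x ∈ X := by
          rw [← f₂]
          refine mem_fv hl ?_
          cases h : l.atom <;> simp_all [Atom.addr?, Atom.vars]
        -- A-completeness leaves two cases. If `M₁` allocates `x`, the cell comes from `h'`; `M₁`
        -- contains the literal or its complement, and the latter is excluded by `hfp`. Otherwise
        -- the cell is that of h, described by the footprint in the formula.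
        rcases avar_or_nvar x hxX with hx | hx
        · rw [Literal.holds_congr_of_map_eq ha (Heap.union_map_of_mem_left hd (dom_avar x hx))]
          have hl' : l ∈ allocPart M₂.core ∪ ptoPart M₂.core := by
            simp only [allocPart, ptoPart, Finset.mem_union, Finset.mem_filter]
            cases h : l.atom <;> simp_all [Atom.addr?, Atom.isAlloc, Atom.isPto]
          have sub : allocPart M₁.core ∪ ptoPart M₁.core ⊆ M₁.core :=
            Finset.union_subset (Finset.filter_subset _ _) (Finset.filter_subset _ _)
          rcases Finset.mem_union.1 (hsub hl') with hl₁ | hl₁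
          · exact core₁ l (sub hl₁)
          · obtain ⟨l₁, hl₂, rfl⟩ := Finset.mem_image.1 hl₁
            have hmem : l₁ ∈ aFootprint M₁.core ∩ complSet M₂.core := by
              refine Finset.mem_inter.2 ⟨Finset.mem_filter.2 ⟨sub hl₂, x, hx, ?_⟩,
                Finset.mem_image.2 ⟨_, hl, ?_⟩⟩
              · cases l₁ <;> simpa [Literal.compl, Literal.atom] using ha
              · cases l₁ <;> rfl
            rw [hfp] at hmem
            simp at hmem
        · rw [Literal.holds_congr_of_map_eq ha (Heap.union_map_of_notMem_left (dom_nvar x hx))]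
          exact fp l (Finset.mem_filter.2 ⟨hl, x, hx, ha⟩)
    refine ⟨h', hd,
      (Minterm.models_iff hU ok₁ _).2 ⟨core₁, dc₁.1, dc₁.2.1, by omega, fun b hb => ?_⟩,
      (Minterm.models_iff hU ok₂ _).2 ⟨core₂, dc₂.1, dc₂.2.1, ?_, fun b hb => ?_⟩⟩
    -- Each of the three candidates in the maximum `e` is below the upper bound of `M₁`, one
    -- hypothesis apiece. The bound of `M₂` on the union is met likewise, which is where the last
    -- conjunct of the formula enters.
    · have := ha₁ b hb; have := dc₁.2.2.2 b hb; have := hge b hb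
      omega
    · rw [Heap.card_union hd]; push_cast; omega
    · have : (h.card : ℤ) < b.val (Nat.card U) - (allocNo M₁.core : ℕ) := ha₂ b hb
      have := dc₂.2.2.2 b hb
      have := hlt b hb
      rw [Heap.card_union hd]; push_cast; omega
  · rintro ⟨h', hd, H₁, H₂⟩
    rw [Minterm.models_iff hU ok₁] at H₁
    rw [Minterm.models_iff hU ok₂] at H₂
    obtain ⟨H₁, lo₁, hi₁, min₁, max₁⟩ := H₁
    obtain ⟨H₂, lo₂, hi₂, min₂, max₂⟩ := H₂
    have q₁ := coreHolds_mono H₁ eqPart_subset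
    have q₂ := coreHolds_mono H₂ eqPart_subset
    have s₁ := ec₁.separates q₁
    have s₂ := ec₂.separates q₂
    rw [holds_domClosureU hU hk ok₁ s₁ f₁.subset, holds_domClosureU hU hk ok₂ s₂ f₂.subset]
    have hcard := Heap.card_union hd
    have ha : allocNo M₁.core ≤ h'.card := by
      have : classCount M₁.core (avar M₁.core) ≤ h'.card := by
        rw [s₁.classCount_eq (avar_subset.trans f₁.subset)]
        refine Set.ncard_le_ncard ?_ h'.dom_finite
        rintro _ ⟨x, hx, rfl⟩
        exact H₁.mem_dom hx
      exact this
    rw [hcard] at min₂ max₂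
    push_cast at min₂ max₂
    refine ⟨⟨H₁.not_ptoConflict, coreHolds_eqPart_congr q₁⟩, coreHolds_eqPart_congr q₂,
      ⟨lo₁, hi₁, fun x hx => H₁.hasFreshTuple hx, fun b hb => min₁.trans_lt (max₁ b hb)⟩,
      ⟨lo₂, hi₂, fun x hx => H₂.hasFreshTuple hx, fun b hb => min₂.trans_lt (max₂ b hb)⟩,
      ?_, ?_, ?_, ?_, ?_, ?_, ?_⟩
    · exact fun x hx => Set.disjoint_left.1 hd (H₁.mem_dom hx)
    · intro l hl
      obtain ⟨hl, x, hx, e⟩ := Finset.mem_filter.1 hl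
      rw [← Literal.holds_congr_of_map_eq e (Heap.union_map_of_notMem_left (H₁.notMem_dom hx))]
      exact H₂ l hl
    · intro b hb
      have := max₁ b hb
      omega
    · intro b hb
      have := max₂ b hb
      omega
    · intro hfin Y hYX hY
      -- These values are free in both heaps, so their number and the size of the union fit together
      -- into U. The minima of `M₁` on `h'` and of `M₂` on the union then give the two halves of λ.
      have hdis : Disjoint (h'.union h).dom (s '' (Y ∩ nvar M₁.core : Finset V)) := by
        rw [Set.disjoint_left, Heap.dom_union]
        rintro _ hl ⟨y, hy, rfl⟩
        obtain ⟨hy, hy'⟩ := Finset.mem_inter.1 hy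
        rcases hl with hl | hl
        exacts [H₁.notMem_dom hy' hl, hY y hy hl]
      have hc : nallocNo Y M₁.core = (s '' (Y ∩ nvar M₁.core : Finset V)).ncard :=
        s₁.classCount_eq (Finset.inter_subset_left.trans hYX)
      have hle : ((h'.union h).dom ∪ s '' (Y ∩ nvar M₁.core : Finset V)).ncard ≤ Nat.card U := by
        rw [← Set.ncard_univ]; exact Set.ncard_le_ncard (Set.subset_univ _)
      rw [Set.ncard_union_eq hdis, ← hc] at hle
      change (h'.union h).card + _ ≤ _ at hle
      omega
    · intro b hb
      have := max₁ b hb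
      omega
    · intro b hb
      have := max₂ b hb
      change (h.card : ℤ) < b.val (Nat.card U) - (allocNo M₁.core : ℕ)
      omega

end Sept

/-! ### Completions of minterms -/

section Completions

variable {k : ℕ} {V : Type v} {U : Type u} {s : V → U} {h : Heap k U} {d : UnivKind}
  {T L : Finset (Literal (Atom k V))}

theorem Literal.compl_compl {α : Type v} (l : Literal α) : l.compl.compl = l := by cases l <;> rfl

theorem Literal.atom_compl {α : Type v} (l : Literal α) : l.compl.atom = l.atom := by
  cases l <;> rfl

theorem mem_complSet [DecidableEq V] {l : Literal (Atom k V)} : l ∈ complSet T ↔ l.compl ∈ T := by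
  rw [complSet, Finset.mem_image]
  constructor
  · rintro ⟨l, hl, rfl⟩; rwa [Literal.compl_compl]
  · exact fun hl => ⟨_, hl, Literal.compl_compl l⟩

theorem mem_complClosure [DecidableEq V] {l : Literal (Atom k V)} :
    l ∈ complClosure T ↔ l ∈ T ∨ l.compl ∈ T := by
  rw [complClosure, Finset.mem_union, mem_complSet]

theorem mem_fv_of_mem_complClosure [DecidableEq V] {l : Literal (Atom k V)} {x : V}
    (hl : l ∈ complClosure T) (hx : x ∈ l.atom.vars) : x ∈ fv T := by
  rcases mem_complClosure.1 hl with hl | hl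
  · exact mem_fv hl hx
  · exact mem_fv hl (by rwa [Literal.atom_compl])

theorem mem_complClosure_filter [DecidableEq V] {p : Atom k V → Prop} [DecidablePred p]
    {l : Literal (Atom k V)} : l ∈ complClosure (T.filter fun l => p l.atom) ↔
      l ∈ complClosure T ∧ p l.atom := by
  simp only [mem_complClosure, Finset.mem_filter, Literal.atom_compl]
  tauto

theorem mem_completions [DecidableEq V] {M N : Minterm k V} : N ∈ completions M L ↔
    ∃ B ⊆ L, N = { M with core := M.core ∪ (B ∪ complSet (L \ B)) } := by
  simp only [completions, List.mem_map, Finset.mem_toList, Finset.mem_powerset, eq_comm]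

section

variable [DecidableEq V] {M N : Minterm k V}

theorem subset_of_mem_completions (hN : N ∈ completions M L) : M.core ⊆ N.core := by
  obtain ⟨B, -, rfl⟩ := mem_completions.1 hN
  exact Finset.subset_union_left

/-- Each literal of `L` enters either as it is or complemented, so the set of decided atoms does not
depend on the chosen `B`. -/
theorem mem_complClosure_completion (hN : N ∈ completions M L) {l : Literal (Atom k V)} :
    l ∈ complClosure N.core ↔ l ∈ complClosure M.core ∨ l ∈ complClosure L := by
  obtain ⟨B, hB, rfl⟩ := mem_completions.1 hN
  have hB₁ : l ∈ B → l ∈ L := fun h => hB h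
  have hB₂ : l.compl ∈ B → l.compl ∈ L := fun h => hB h
  simp only [mem_complClosure, Finset.mem_union, mem_complSet, Finset.mem_sdiff,
    Literal.compl_compl]
  tauto

theorem fv_completion_subset (hN : N ∈ completions M L) {X : Finset V} (hM : fv M.core ⊆ X)
    (hL : fv L ⊆ X) : fv N.core ⊆ X := by
  intro x hx
  obtain ⟨l, hl, hx⟩ := Finset.mem_biUnion.1 hx
  rcases (mem_complClosure_completion hN).1 (mem_complClosure.2 (Or.inl hl)) with hl | hl
  · exact hM (mem_fv_of_mem_complClosure hl hx)
  · exact hL (mem_fv_of_mem_complClosure hl hx)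

theorem Minterm.Ok.completion (hM : M.Ok d) (hN : N ∈ completions M L) : N.Ok d := by
  obtain ⟨B, -, rfl⟩ := mem_completions.1 hN
  exact hM

theorem Minterm.Models.of_completion (hN : N ∈ completions M L) (H : N.Models s h) :
    M.Models s h := by
  have := coreHolds_mono H.1 (subset_of_mem_completions hN)
  obtain ⟨B, -, rfl⟩ := mem_completions.1 hN
  exact ⟨this, H.2⟩

/-- The model itself selects `B`: the literals of `L` that are true in it. -/
theorem Minterm.Models.exists_completion (H : M.Models s h) (L : Finset (Literal (Atom k V))) :
    ∃ N ∈ completions M L, N.Models s h := by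
  classical
  refine ⟨_, mem_completions.2 ⟨L.filter fun l => l.Holds (Atom.Holds s h),
    Finset.filter_subset _ _, rfl⟩, ?_, H.2⟩
  rw [coreHolds_union, coreHolds_union]
  refine ⟨H.1, fun l hl => (Finset.mem_filter.1 hl).2, fun l hl => ?_⟩
  rw [mem_complSet, Finset.mem_sdiff, Finset.mem_filter, not_and] at hl
  have := hl.2 hl.1
  rwa [Literal.holds_compl, not_not] at this

end

theorem fv_eqs [DecidableEq V] (X : Finset V) : fv (eqs (k := k) X) ⊆ X := by
  intro x hx
  obtain ⟨l, hl, hx⟩ := Finset.mem_biUnion.1 hx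
  obtain ⟨⟨a, b⟩, hp, rfl⟩ := Finset.mem_image.1 hl
  simp only [Finset.mem_product] at hp
  simp only [Literal.atom, Atom.vars, Finset.mem_insert, Finset.mem_singleton] at hx
  rcases hx with rfl | rfl
  exacts [hp.1, hp.2]

theorem fv_allocs [DecidableEq V] (X : Finset V) : fv (allocs (k := k) X) ⊆ X := by
  intro x hx
  obtain ⟨l, hl, hx⟩ := Finset.mem_biUnion.1 hx
  obtain ⟨a, ha, rfl⟩ := Finset.mem_image.1 hl
  obtain rfl : x = a := by simpa [Literal.atom, Atom.vars] using hx
  exact ha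

theorem CoreHolds.xor_of_mem_complClosure [DecidableEq V] (H : CoreHolds s h T) {a : Atom k V}
    (ha : .pos a ∈ complClosure T) : Xor (Literal.pos a ∈ T) (Literal.neg a ∈ T) := by
  rcases mem_complClosure.1 ha with ha | ha
  · exact Or.inl ⟨ha, fun hn => H _ hn (H _ ha)⟩
  · exact Or.inr ⟨ha, fun hn => H _ ha (H _ hn)⟩

theorem CoreHolds.eComplete [DecidableEq V] (H : CoreHolds s h T) {X Y : Finset V}
    (hT : ∀ l ∈ eqs (k := k) X, l ∈ complClosure T) (hY : Y ⊆ X) : EComplete T Y :=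
  fun x hx y hy => H.xor_of_mem_complClosure
    (hT _ (Finset.mem_image.2 ⟨(x, y), Finset.mem_product.2 ⟨hY hx, hY hy⟩, rfl⟩))

theorem CoreHolds.aComplete [DecidableEq V] (H : CoreHolds s h T) {X Y : Finset V}
    (hT : ∀ l ∈ allocs (k := k) X, l ∈ complClosure T) (hY : Y ⊆ X) : AComplete T Y :=
  fun x hx => H.xor_of_mem_complClosure (hT _ (Finset.mem_image.2 ⟨x, hY hx, rfl⟩))

end Completions

/-! ### The separating connectives between disjunctions of minterms -/

section Connectives

variable {k : ℕ} {V : Type v} {U : Type u} {s : V → U} {d : UnivKind} [DecidableEq V]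

/-- Completeness comes from the construction, consistency from the heaps. Filtering by readiness
therefore discards no pair that is satisfied over a common store. -/
theorem starReady_of_models {M₁ M₂ N₁ N₂ P₁ P₂ : Minterm k V} {h₁ h₂ : Heap k U}
    (hN₁ : N₁ ∈ completions M₁ (eqs (fv (M₁.core ∪ M₂.core))))
    (hN₂ : N₂ ∈ completions M₂ (eqs (fv (M₁.core ∪ M₂.core))))
    (hP₁ : P₁ ∈ completions N₁ (ptoPart N₂.core)) (hP₂ : P₂ ∈ completions N₂ (ptoPart N₁.core))
    (H₁ : CoreHolds s h₁ P₁.core) (H₂ : CoreHolds s h₂ P₂.core) : StarReady P₁ P₂ := by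
  have v₁ := fv_completion_subset hN₁ (fv_mono Finset.subset_union_left) (fv_eqs _)
  have v₂ := fv_completion_subset hN₂ (fv_mono Finset.subset_union_right) (fv_eqs _)
  have w₁ := fv_completion_subset hP₁ v₁ ((fv_mono (Finset.filter_subset _ _)).trans v₂)
  have w₂ := fv_completion_subset hP₂ v₂ ((fv_mono (Finset.filter_subset _ _)).trans v₁)
  have w : fv (P₁.core ∪ P₂.core) ⊆ fv (M₁.core ∪ M₂.core) := by
    rw [fv, Finset.union_biUnion]
    exact Finset.union_subset w₁ w₂
  refine ⟨H₁.footprintConsistent, H₂.footprintConsistent, H₁.eComplete (fun l hl => ?_) w,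
    H₂.eComplete (fun l hl => ?_) w, ?_⟩
  · exact (mem_complClosure_completion hP₁).2 (Or.inl ((mem_complClosure_completion hN₁).2
      (Or.inr (mem_complClosure.2 (Or.inl hl)))))
  · exact (mem_complClosure_completion hP₂).2 (Or.inl ((mem_complClosure_completion hN₂).2
      (Or.inr (mem_complClosure.2 (Or.inl hl)))))
  · have e : ∀ {T : Finset (Literal (Atom k V))} {l : Literal (Atom k V)},
        l ∈ complClosure (ptoPart T) ↔ l ∈ complClosure T ∧ l.atom.isPto = true :=
      mem_complClosure_filter (p := fun a => a.isPto = true)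
    ext l
    simp only [e, mem_complClosure_completion hP₁, mem_complClosure_completion hP₂]
    tauto

theorem represents_starMinterms (hU : Fits d U) (hk : 0 < k) {S T : List (Minterm k V)}
    {p q : Heap k U → Prop} (hS : Represents d s S p) (hT : Represents d s T q) :
    Represents d s (starMinterms S T) fun h =>
      ∃ h₁ h₂ : Heap k U, h₁.Disj h₂ ∧ h = h₁.union h₂ ∧ p h₁ ∧ q h₂ := by
  -- Readiness is made part of the represented property, so that a rejected pair represents falsity.
  refine (represents_flatMap fun M₁ hM₁ => represents_flatMap fun M₂ hM₂ =>
    represents_flatMap fun N₁ hN₁ => represents_flatMap fun N₂ hN₂ =>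
    represents_flatMap fun P₁ hP₁ => represents_flatMap (p := fun P₂ h => StarReady P₁ P₂ ∧
      ∃ h₁ h₂ : Heap k U, h₁.Disj h₂ ∧ h = h₁.union h₂ ∧ P₁.Models s h₁ ∧ P₂.Models s h₂)
      fun P₂ hP₂ => ?_).congr fun h => ?_
  · have ok₁ := ((hS.1 M₁ hM₁).completion hN₁).completion hP₁
    have ok₂ := ((hT.1 M₂ hM₂).completion hN₂).completion hP₂
    by_cases hR : StarReady P₁ P₂
    · rw [if_pos hR]
      refine (BoolComb.represents_minterms hU (elimStar_all ok₁ ok₂)).congr fun h => ?_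
      rw [holds_elimStar_iff hU hk ok₁ ok₂ hR, and_iff_right hR]
    · rw [if_neg hR]
      exact represents_nil.congr fun h => by simp [hR]
  · constructor
    · rintro ⟨M₁, hM₁, M₂, hM₂, N₁, hN₁, N₂, hN₂, P₁, hP₁, P₂, hP₂, -, h₁, h₂, hd, e, H₁, H₂⟩
      exact ⟨h₁, h₂, hd, e, (hS.2 h₁).1 ⟨M₁, hM₁, (H₁.of_completion hP₁).of_completion hN₁⟩,
        (hT.2 h₂).1 ⟨M₂, hM₂, (H₂.of_completion hP₂).of_completion hN₂⟩⟩
    · rintro ⟨h₁, h₂, hd, e, H₁, H₂⟩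
      obtain ⟨M₁, hM₁, H₁⟩ := (hS.2 h₁).2 H₁
      obtain ⟨M₂, hM₂, H₂⟩ := (hT.2 h₂).2 H₂
      obtain ⟨N₁, hN₁, H₁⟩ := H₁.exists_completion (eqs (fv (M₁.core ∪ M₂.core)))
      obtain ⟨N₂, hN₂, H₂⟩ := H₂.exists_completion (eqs (fv (M₁.core ∪ M₂.core)))
      obtain ⟨P₁, hP₁, H₁⟩ := H₁.exists_completion (ptoPart N₂.core)
      obtain ⟨P₂, hP₂, H₂⟩ := H₂.exists_completion (ptoPart N₁.core)
      exact ⟨M₁, hM₁, M₂, hM₂, N₁, hN₁, N₂, hN₂, P₁, hP₁, P₂, hP₂,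
        starReady_of_models hN₁ hN₂ hP₁ hP₂ H₁.1 H₂.1, h₁, h₂, hd, e, H₁, H₂⟩

theorem septReady_of_models {M₁ M₂ N₁ N₂ P₁ Q₁ : Minterm k V} {h h' : Heap k U} (hd : h'.Disj h)
    (hN₁ : N₁ ∈ completions M₁ (eqs (fv (M₁.core ∪ M₂.core))))
    (hN₂ : N₂ ∈ completions M₂ (eqs (fv (M₁.core ∪ M₂.core))))
    (hP₁ : P₁ ∈ completions N₁ (allocs (fv (M₁.core ∪ M₂.core))))
    (hQ₁ : Q₁ ∈ completions P₁ (allocPart M₂.core ∪ ptoPart M₂.core))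
    (H₁ : CoreHolds s h' Q₁.core) (H₂ : CoreHolds s (h'.union h) N₂.core) : SeptReady Q₁ N₂ := by
  have sub : ∀ T : Finset (Literal (Atom k V)), allocPart T ∪ ptoPart T ⊆ T := fun T =>
    Finset.union_subset (Finset.filter_subset _ _) (Finset.filter_subset _ _)
  have v₁ := fv_completion_subset hN₁ (fv_mono Finset.subset_union_left) (fv_eqs _)
  have v₂ := fv_completion_subset hN₂ (fv_mono Finset.subset_union_right) (fv_eqs _)
  have w₁ := fv_completion_subset hQ₁ (fv_completion_subset hP₁ v₁ (fv_allocs _))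
    (fv_mono ((sub _).trans Finset.subset_union_right))
  have w : fv (Q₁.core ∪ N₂.core) ⊆ fv (M₁.core ∪ M₂.core) := by
    rw [fv, Finset.union_biUnion]
    exact Finset.union_subset w₁ v₂
  refine ⟨H₁.footprintConsistent, H₂.footprintConsistent, H₁.eComplete (fun l hl => ?_) w,
    H₂.eComplete (fun l hl => ?_) w, H₁.aComplete (fun l hl => ?_) w, fun l hl => ?_, ?_⟩
  · exact (mem_complClosure_completion hQ₁).2 (Or.inl ((mem_complClosure_completion hP₁).2
      (Or.inl ((mem_complClosure_completion hN₁).2 (Or.inr (mem_complClosure.2 (Or.inl hl)))))))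
  · exact (mem_complClosure_completion hN₂).2 (Or.inr (mem_complClosure.2 (Or.inl hl)))
  · exact (mem_complClosure_completion hQ₁).2 (Or.inl ((mem_complClosure_completion hP₁).2
      (Or.inr (mem_complClosure.2 (Or.inl hl)))))
  · have e : ∀ T : Finset (Literal (Atom k V)), allocPart T ∪ ptoPart T =
        T.filter fun l => l.atom.isAlloc = true ∨ l.atom.isPto = true := fun T =>
      (Finset.filter_or _ _ _).symm
    have e' : ∀ {T : Finset (Literal (Atom k V))} {l : Literal (Atom k V)},
        l ∈ complClosure (allocPart T ∪ ptoPart T) ↔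
          l ∈ complClosure T ∧ (l.atom.isAlloc = true ∨ l.atom.isPto = true) := by
      intro T l
      rw [e]
      exact mem_complClosure_filter (p := fun a => a.isAlloc = true ∨ a.isPto = true)
    rw [e, Finset.mem_filter] at hl
    obtain ⟨hl, ha⟩ := hl
    rw [e', mem_complClosure_completion hQ₁, e']
    refine ⟨Or.inr ⟨?_, ha⟩, ha⟩
    -- `N₂` adds only equality literals to `M₂`, so its literals about the heap stem from `M₂` and
    -- are decided in `Q₁`.
    refine ((mem_complClosure_completion hN₂).1 (mem_complClosure.2 (Or.inl hl))).resolve_right ?_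
    intro hl'
    have : l.atom.isEq = true := by
      rcases mem_complClosure.1 hl' with hl' | hl' <;>
        obtain ⟨_, -, e⟩ := Finset.mem_image.1 hl'
      · rw [← e]; rfl
      · rw [← Literal.atom_compl, ← e]; rfl
    cases h : l.atom <;> simp_all [Atom.isEq, Atom.isAlloc, Atom.isPto]
  · refine Finset.eq_empty_of_forall_notMem fun l hl => ?_
    obtain ⟨hl, hl'⟩ := Finset.mem_inter.1 hl
    obtain ⟨hl, x, hx, ha⟩ := Finset.mem_filter.1 hl
    -- The cell of a variable allocated by `Q₁` is the same in `h'` and in the union, so the literal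
    -- and its complement would both hold there.
    have hc := H₂ _ (mem_complSet.1 hl')
    rw [Literal.holds_compl, Literal.holds_congr_of_map_eq ha
      (Heap.union_map_of_mem_left hd (H₁.mem_dom hx))] at hc
    exact hc (H₁ l hl)

theorem represents_septMinterms (hU : Fits d U) (hk : 0 < k) {S T : List (Minterm k V)}
    {p q : Heap k U → Prop} (hS : Represents d s S p) (hT : Represents d s T q) :
    Represents d s (septMinterms d S T) fun h =>
      ∃ h' : Heap k U, h'.Disj h ∧ p h' ∧ q (h'.union h) := by
  refine (represents_flatMap fun M₁ hM₁ => represents_flatMap fun M₂ hM₂ =>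
    represents_flatMap fun N₁ hN₁ => represents_flatMap fun N₂ hN₂ =>
    represents_flatMap fun P₁ hP₁ => represents_flatMap (p := fun Q₁ h => SeptReady Q₁ N₂ ∧
      ∃ h' : Heap k U, h'.Disj h ∧ Q₁.Models s h' ∧ N₂.Models s (h'.union h))
      fun Q₁ hQ₁ => ?_).congr fun h => ?_
  · have ok₁ := (((hS.1 M₁ hM₁).completion hN₁).completion hP₁).completion hQ₁
    have ok₂ := (hT.1 M₂ hM₂).completion hN₂
    by_cases hR : SeptReady Q₁ N₂
    · rw [if_pos hR]
      refine (BoolComb.represents_minterms hU (elimSept_all ok₁ ok₂)).congr fun h => ?_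
      rw [holds_elimSept_iff hU hk ok₁ ok₂ hR, and_iff_right hR]
    · rw [if_neg hR]
      exact represents_nil.congr fun h => by simp [hR]
  · constructor
    · rintro ⟨M₁, hM₁, M₂, hM₂, N₁, hN₁, N₂, hN₂, P₁, hP₁, Q₁, hQ₁, -, h', hd, H₁, H₂⟩
      exact ⟨h', hd, (hS.2 h').1 ⟨M₁, hM₁,
        ((H₁.of_completion hQ₁).of_completion hP₁).of_completion hN₁⟩,
        (hT.2 _).1 ⟨M₂, hM₂, H₂.of_completion hN₂⟩⟩
    · rintro ⟨h', hd, H₁, H₂⟩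
      obtain ⟨M₁, hM₁, H₁⟩ := (hS.2 h').2 H₁
      obtain ⟨M₂, hM₂, H₂⟩ := (hT.2 _).2 H₂
      obtain ⟨N₁, hN₁, H₁⟩ := H₁.exists_completion (eqs (fv (M₁.core ∪ M₂.core)))
      obtain ⟨N₂, hN₂, H₂⟩ := H₂.exists_completion (eqs (fv (M₁.core ∪ M₂.core)))
      obtain ⟨P₁, hP₁, H₁⟩ := H₁.exists_completion (allocs (fv (M₁.core ∪ M₂.core)))
      obtain ⟨Q₁, hQ₁, H₁⟩ := H₁.exists_completion (allocPart M₂.core ∪ ptoPart M₂.core)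
      exact ⟨M₁, hM₁, M₂, hM₂, N₁, hN₁, N₂, hN₂, P₁, hP₁, Q₁, hQ₁,
        septReady_of_models hd hN₁ hN₂ hP₁ hQ₁ H₁.1 H₂.1, h', hd, H₁, H₂⟩

/-- Every quantifier-free formula is equivalent to the disjunction of its minterms. -/
theorem represents_mu (hU : Fits d U) (hk : 0 < k) (φ : Formula k V) :
    Represents d s (mu d φ) fun h => Sat s h φ := by
  -- The recursion is not structural: a septraction descends past the inner negation to `ψ`, whereas
  -- any other wand calls on `.neg ψ`, which is no subformula.
  induction φ using mu.induct with
  | case1 => rw [mu]; exact represents_nil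
  | case2 => rw [mu]; exact represents_trivial
  | case3 =>
    rw [mu]
    simp [Represents, Minterm.Ok, Bound.Ok, Minterm.Models, CoreHolds, Bound.test, Test.Holds, Sat,
      Heap.eq_empty_iff_card]
  | case4 x y =>
    rw [mu]
    simp [Represents, Minterm.Ok, Bound.Ok, Minterm.Models, CoreHolds, Bound.test, Test.Holds, Sat,
      Literal.Holds, Atom.Holds]
  | case5 x y =>
    rw [mu]
    refine ⟨by simp [Minterm.Ok, Bound.Ok], fun h => ?_⟩
    change _ ↔ Sat s h (.pto x y)
    rw [sat_pto_iff]
    simp only [List.mem_singleton, exists_eq_left]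
    simp only [Minterm.Models, CoreHolds, Finset.mem_singleton, forall_eq, Literal.Holds,
      Atom.Holds, Bound.test, Test.Holds, Option.mem_def, Option.some.injEq, forall_eq']
    refine ⟨fun ⟨e, _, _, h₁, h₂⟩ => ⟨e, ?_⟩, fun ⟨e, hd⟩ => ⟨e, by simp, by simp, ?_, ?_⟩⟩
    -- The bounds 1 ≤ |h| < 2 leave a single location, and the points-to literal identifies it as `s
    -- x`.
    · obtain ⟨a, ha⟩ := Set.ncard_eq_one.1 (show h.dom.ncard = 1 by rw [Heap.card] at *; omega)
      have := Heap.mem_dom_of_map_eq_some e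
      rw [ha] at this ⊢
      rw [Set.mem_singleton_iff.1 this]
    · simp [Heap.card, hd]
    · simp [Heap.card, hd]
  | case6 φ ψ ih₁ ih₂ => rw [mu]; exact represents_andMinterms hU ih₁ ih₂
  | case7 φ ψ ih₁ ih₂ => rw [mu]; exact represents_starMinterms hU hk ih₁ ih₂
  | case8 φ ψ ih₁ ih₂ =>
    rw [mu]
    exact (represents_septMinterms hU hk ih₁ ih₂).congr fun h => (sat_sept s h φ ψ).symm
  | case9 φ hφ ih => rw [mu]; exact represents_negMinterms hU ih; exact hφ
  | case10 φ ψ ih₁ ih₂ =>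
    rw [mu]
    refine (represents_negMinterms hU (represents_septMinterms hU hk ih₁ ih₂)).congr fun h => ?_
    simp [Sat]

end Connectives

end SepLog

/-! ### The equivalences over finite and over infinite universes -/

theorem mainTheorem4 {k : ℕ} (hk : 0 < k) {V : Type v} [DecidableEq V] (φ : SepLog.Formula k V) :
    SepLog.EquivFin.{u, v} φ
      (SepLog.Formula.disj ((SepLog.mu SepLog.UnivKind.fin φ).map SepLog.Minterm.toFormula)) ∧
    SepLog.EquivInf.{u, v} φ
      (SepLog.Formula.disj ((SepLog.mu SepLog.UnivKind.inf φ).map SepLog.Minterm.toFormula)) := by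
  constructor
  · intro U hne hfin s h
    rw [SepLog.sat_disj_minterms]
    exact ((SepLog.represents_mu (d := .fin) ⟨hfin, hne⟩ hk φ).2 h).symm
  · intro U hinf s h
    rw [SepLog.sat_disj_minterms]
    exact ((SepLog.represents_mu (d := .inf) hinf hk φ).2 h).symm
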